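/- Alice prepares $n$ EPR pairs, each in the state $(|00\rangle+|11\rangle)/\sqrt2$, and sends the second half of each pair to Bob through a channel that applies an arbitrary superoperator to at most $t$ of the $n$ transmitted qubits and the identity to the others. A (stabilizer) two-way entanglement purification protocol (2-EPP) is the following: Alice and Bob measure commuting Pauli operators one after another, each on their own halves, and exchange their results after each measurement; the next operator may depend on all earlier results. Finally they apply local unitaries, which may depend on all the results, keep $k$ of the pairs and discard the rest. It produces $k$ perfect EPR pairs from $n$ pairs under at most $t$ errors if, for every such channel and every sequence of measurement results of nonzero probability, the state of the $k$ kept pairs is exactly that of $k$ EPR pairs. The following hold. 1. The operators $X\otimes X\otimes X\otimes X$ and $Z\otimes Z\otimes Z\otimes Z$ commute, their joint $+1$-eigenspace has dimension $2^2$, and every non-identity single-qubit Pauli operator on four qubits fails to commute with at least one of them; that is, they generate the stabilizer of a $[[4,2]]$ code that detects every single-qubit error. 2. There is a 2-EPP that produces $2$ perfect EPR pairs from $6$ pairs under at most one error. Namely, Alice and Bob measure $X\otimes X\otimes X\otimes X$ and then $Z\otimes Z\otimes Z\otimes Z$ on the first four pairs and compare their results. If their results differ for at least one of the two operators (nonzero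 error syndrome), they discard the first four pairs and keep the last two unchanged. If their results agree for both operators, each of them applies to their first four qubits a unitary decoding operation for the four-qubit code with the syndrome given by their results, that is, a unitary that takes the joint eigenspace belonging to those results onto the states whose last two of the four qubits are $|00\rangle$; they keep the first two pairs and discard the others. For a suitable choice of these decoding operations, the same for Alice and Bob, this protocol produces $2$ perfect EPR pairs under at most one error. 3. No qubit quantum error-correcting code, additive or not, achieves this: there are no encoding channel from $2$ qubits to $6$ qubits and decoding channel from $6$ qubits to $2$ qubits, with no further communication, such that every state of the $2$ qubits is recovered exactly after an arbitrary superoperator on at most one of the $6$ qubits. -/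

import Mathlib

open scoped Matrix Kronecker ComplexOrder

noncomputable section

namespace TwoWayEPP

/-- Computational basis labels of `n` qubits; operators on `n` qubits are matrices over these. -/
abbrev Qubits (n : ℕ) : Type := Fin n → Fin 2

/-- Operators on `n` qubits. -/
abbrev Op (n : ℕ) : Type := Matrix (Qubits n) (Qubits n) ℂ

/-- Operators on `n` pairs: the first factor is held by Alice, the second one by Bob. -/
abbrev PairOp (n : ℕ) : Type := Matrix (Qubits n × Qubits n) (Qubits n × Qubits n) ℂ

/-! ### Pauli operators -/

/-- The four single-qubit Pauli labels. -/
inductive Pauli : Type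
  | I | X | Y | Z

/-- The `2 × 2` matrix of a Pauli label. -/
def Pauli.toMatrix : Pauli → Matrix (Fin 2) (Fin 2) ℂ
  | .I => 1
  | .X => !![0, 1; 1, 0]
  | .Y => !![0, -Complex.I; Complex.I, 0]
  | .Z => !![1, 0; 0, -1]

/-- The tensor product of the Pauli matrices `P 0, …, P (n - 1)`. -/
def pauliOp {n : ℕ} (P : Fin n → Pauli) : Op n :=
  Matrix.of fun x y => ∏ i, (P i).toMatrix (x i) (y i)

/-- The eigenvalue `(-1)^a` that belongs to the measurement result `a`. -/
def sign (a : Bool) : ℂ := if a then -1 else 1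

/-- The projector onto the `(-1)^a`-eigenspace of a Pauli operator. -/
def pauliProj {n : ℕ} (P : Fin n → Pauli) (a : Bool) : Op n :=
  (1 / 2 : ℂ) • (1 + sign a • pauliOp P)

/-- For a list of Pauli operators with prescribed results, the space of all states on which
every listed operator has the eigenvalue given by its result. -/
def syndromeSpace {n : ℕ} (S : List ((Fin n → Pauli) × Bool)) : Submodule ℂ (Qubits n → ℂ) where
  carrier := {ψ | ∀ p ∈ S, pauliOp p.1 *ᵥ ψ = sign p.2 • ψ}
  add_mem' := by
    intro ψ φ hψ hφ p hp
    rw [Matrix.mulVec_add, hψ p hp, hφ p hp, smul_add]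
  zero_mem' := by
    intro p _
    simp
  smul_mem' := by
    intro c ψ hψ p hp
    rw [Matrix.mulVec_smul, hψ p hp, smul_comm]

/-! ### Quantum channels -/

/-- The superoperator `ρ ↦ ∑ i, K i * ρ * (K i)ᴴ`. -/
def applyKraus {ι κ : Type*} [Fintype ι] {r : ℕ}
    (K : Fin r → Matrix κ ι ℂ) (ρ : Matrix ι ι ℂ) : Matrix κ κ ℂ :=
  ∑ i, K i * ρ * (K i)ᴴ

/-- The Kraus operators `K` define a (trace preserving) quantum channel. -/
def IsChannel {ι κ : Type*} [Fintype κ] [DecidableEq ι] {r : ℕ}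
    (K : Fin r → Matrix κ ι ℂ) : Prop :=
  ∑ i, (K i)ᴴ * K i = 1

/-- The operator on `n` qubits that acts as `A` on the qubits `e 0, …, e (m - 1)` and as the
identity on the others. -/
def actOn {m n : ℕ} (e : Fin m ↪ Fin n) (A : Op m) : Op n :=
  Matrix.of fun x y =>
    if ∀ i, (∀ j, e j ≠ i) → x i = y i then A (fun j => x (e j)) (fun j => y (e j)) else 0

/-! ### EPR pairs -/

/-- The density matrix of `n` perfect EPR pairs `(|00⟩ + |11⟩) / √2`, that is, of the state
`2^(-n/2) ∑ x, |x⟩ ⊗ |x⟩`. -/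
def eprState (n : ℕ) : PairOp n :=
  Matrix.of fun p q => if p.1 = p.2 ∧ q.1 = q.2 then ((2 : ℂ) ^ n)⁻¹ else 0

/-- Discard (trace out) all pairs except the pairs `keep 0, …, keep (k - 1)`. -/
def keepPairs {n k : ℕ} (keep : Fin k ↪ Fin n) (ρ : PairOp n) : PairOp k :=
  Matrix.of fun p q =>
    ∑ x : Qubits n × Qubits n, ∑ y : Qubits n × Qubits n,
      if (∀ j, x.1 (keep j) = p.1 j ∧ x.2 (keep j) = p.2 j ∧
            y.1 (keep j) = q.1 j ∧ y.2 (keep j) = q.2 j) ∧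
          (∀ i, (∀ j, keep j ≠ i) → x.1 i = y.1 i ∧ x.2 i = y.2 i)
      then ρ x y else 0

/-! ### Two-way entanglement purification protocols -/

/-- A two-way protocol on `n` pairs with `k` output pairs.

* `measure M next`: Alice and Bob both measure the Pauli operator `M` on their halves, get the
  results `a` and `b`, tell each other, and go on with `next a b`.
* `finish UA UB keep`: Alice applies `UA`, Bob applies `UB`, and they output the pairs
  `keep 0, …, keep (k - 1)`, discarding all others.

All later choices may depend on all earlier results of both parties. -/
inductive Protocol (n k : ℕ) : Type
  | measure (M : Fin n → Pauli) (next : Bool → Bool → Protocol n k) : Protocol n k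
  | finish (UA UB : Op n) (keep : Fin k ↪ Fin n) : Protocol n k

/-- Each operator measured commutes with those in `past` and with those measured before it, and
the final local operations are unitary. -/
def Protocol.IsValidAfter {n k : ℕ} : Protocol n k → List (Fin n → Pauli) → Prop
  | .measure M next, past =>
      (∀ L ∈ past, Commute (pauliOp L) (pauliOp M)) ∧
        ∀ a b, (next a b).IsValidAfter (M :: past)
  | .finish UA UB _, _ =>
      UA ∈ Matrix.unitaryGroup (Qubits n) ℂ ∧ UB ∈ Matrix.unitaryGroup (Qubits n) ℂ

/-- The protocol is a (stabilizer) 2-EPP. -/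
def Protocol.IsTwoEPP {n k : ℕ} (P : Protocol n k) : Prop :=
  P.IsValidAfter []

/-- Run on the state `ρ`, the protocol ends, whatever the measurement results, with `k` perfect
EPR pairs. States after a measurement are not normalized, so that the trace of the final state is
the probability of the branch, and the claim is void exactly for branches of probability zero. -/
def Protocol.AlwaysPerfect {n k : ℕ} : Protocol n k → PairOp n → Prop
  | .measure M next, ρ =>
      ∀ a b, (next a b).AlwaysPerfect
        ((pauliProj M a ⊗ₖ pauliProj M b) * ρ * (pauliProj M a ⊗ₖ pauliProj M b)ᴴ)
  | .finish UA UB keep, ρ =>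
      keepPairs keep ((UA ⊗ₖ UB) * ρ * (UA ⊗ₖ UB)ᴴ) = ρ.trace • eprState k

/-- The protocol produces `k` perfect EPR pairs from `n` pairs whenever Bob's halves went through
a channel that acts, by an arbitrary superoperator, on at most `t` of the qubits. -/
def Protocol.Corrects {n k : ℕ} (P : Protocol n k) (t : ℕ) : Prop :=
  ∀ (m : ℕ), m ≤ t → ∀ (e : Fin m ↪ Fin n) (r : ℕ) (N : Fin r → Op m), IsChannel N →
    P.AlwaysPerfect (applyKraus (fun i => (1 : Op n) ⊗ₖ actOn e (N i)) (eprState n))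

/-! ### Quantum error-correcting codes -/

/-- There is a QECC (additive or not) that encodes `k` qubits into `n` qubits, with an encoding
`E` and a decoding `D` independent of the noise, and recovers every encoded state exactly after
an arbitrary superoperator on at most `t` of the `n` qubits. Encodings by isometries are the case
of one Kraus operator. -/
def ExistsQECC (n k t : ℕ) : Prop :=
  ∃ (rE rD : ℕ) (E : Fin rE → Matrix (Qubits n) (Qubits k) ℂ)
    (D : Fin rD → Matrix (Qubits k) (Qubits n) ℂ),
    IsChannel E ∧ IsChannel D ∧
      ∀ (m : ℕ), m ≤ t → ∀ (e : Fin m ↪ Fin n) (r : ℕ) (N : Fin r → Op m), IsChannel N →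
        ∀ ρ : Op k, ρ.PosSemidef → ρ.trace = 1 →
          applyKraus D (applyKraus (fun i => actOn e (N i)) (applyKraus E ρ)) = ρ

/-! ### The six-pair protocol -/

/-- `X ⊗ X ⊗ X ⊗ X`. -/
def xxxx : Fin 4 → Pauli := fun _ => .X

/-- `Z ⊗ Z ⊗ Z ⊗ Z`. -/
def zzzz : Fin 4 → Pauli := fun _ => .Z

/-- A four-qubit Pauli operator on the first four of six qubits. -/
def onFirstFour (P : Fin 4 → Pauli) : Fin 6 → Pauli :=
  fun i => if h : i.val < 4 then P ⟨i.val, h⟩ else .I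

/-- `U` decodes the `k` qubits encoded in `syndromeSpace S`: it is unitary and takes that space
to states whose qubits outside `keep` are all `|0⟩`. (For `n - k` independent commuting operators
in `S` this makes `U` a bijection onto the states of the qubits in `keep`.) -/
def IsDecoding {n k : ℕ} (S : List ((Fin n → Pauli) × Bool)) (keep : Fin k ↪ Fin n)
    (U : Op n) : Prop :=
  U ∈ Matrix.unitaryGroup (Qubits n) ℂ ∧
    ∀ ψ ∈ syndromeSpace S, ∀ x : Qubits n,
      (∃ i, (∀ j, keep j ≠ i) ∧ x i ≠ 0) → (U *ᵥ ψ) x = 0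

/-- Measure `XXXX`, then `ZZZZ` on the first four pairs. If the results of Alice and Bob agree for
both (zero syndrome), both decode the first four qubits by `D`, chosen by their results, and keep
the two decoded pairs. Otherwise discard the first four pairs and keep the last two as they are. -/
def sixPairProtocol (D : Bool → Bool → Op 4) : Protocol 6 2 :=
  .measure (onFirstFour xxxx) fun a₁ b₁ =>
    .measure (onFirstFour zzzz) fun a₂ b₂ =>
      if a₁ = b₁ ∧ a₂ = b₂ then
        .finish (actOn (Fin.castLEEmb (by norm_num : 4 ≤ 6)) (D a₁ a₂))
          (actOn (Fin.castLEEmb (by norm_num : 4 ≤ 6)) (D b₁ b₂))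
          (Fin.castLEEmb (by norm_num : 2 ≤ 6))
      else
        .finish 1 1 (Fin.natAddEmb 4)

end TwoWayEPP

end

/-! A pure state of the pairs is encoded by its matrix of amplitudes `M`; local operators `A`, `B`
turn it into `A * M * Bᵀ` (`kronecker_conj_pureState`), and EPR pairs with an error `N` on Bob's
side have amplitudes `Nᵀ` up to a scalar. As the success condition is linear in the state, one Kraus
operator at a time suffices. After the measurements the amplitudes are `Π * N * Π'`, with `Π`, `Π'`
the code projectors for the results of Alice and Bob. An error on the first four qubits satisfies `Π
* N * Π = c • Π`, because every non-identity single-qubit Pauli anticommutes with `XXXX` or `ZZZZ`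
(`codeProj_mul_qubitOp`); an error elsewhere commutes with `Π`. So equal results leave `Π` times an
operator on the last two qubits, and the decoder turns `Π` into the identity on two qubits times
`|00⟩⟨00|`. Unequal results either have probability zero or show that the error was among the first
four pairs, so that the last two are intact.

For the impossibility, exact recovery yields an isometry with the Knill-Laflamme conditions
(`exists_knillLaflamme_of_existsQECC`). The Hamming bound needs a nondegenerate code, so purity of
the code is proved first. Group the six qubits into three ququarts and let `p₁`, `p₂`, `p₃` be the
purities of their reduced states. None of them is correlated with a four-dimensional reference
system; comparing the purity of reference plus first ququart with that of the complementary two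
gives `p₂ + p₃ - 1/4 ≤ p₁` (`purity_le_of_no_leak`). Adding the same inequality with the first two
exchanged gives `p₃ ≤ 1/4`, hence a maximally mixed third ququart (`eq_of_no_leak`). By symmetry
this holds for every pair of qubits, so the `1 + 3 * 6 = 19` Pauli errors of weight at most one take
the code to mutually orthogonal spaces of dimension `4`. But `19 * 4 = 76 > 64`. -/

namespace TwoWayEPP

/-! ### Tensor products, single-qubit operators and Pauli algebra. -/

/-- The tensor product of single-qubit matrices. -/
def tensorOp {n : ℕ} (A : Fin n → Matrix (Fin 2) (Fin 2) ℂ) : Op n :=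
  Matrix.of fun x y => ∏ i, A i (x i) (y i)

/-- The single-qubit matrix `A` acting on qubit `i`. -/
def qubitOp {n : ℕ} (i : Fin n) (A : Matrix (Fin 2) (Fin 2) ℂ) : Op n :=
  tensorOp (Function.update 1 i A)

theorem tensorOp_one {n : ℕ} : tensorOp (1 : Fin n → Matrix (Fin 2) (Fin 2) ℂ) = 1 := by
  ext x y
  simp only [tensorOp, Matrix.of_apply, Pi.one_apply, Matrix.one_apply]
  rw [Finset.prod_ite_zero]
  simp [funext_iff]

theorem tensorOp_mul {n : ℕ} (A B : Fin n → Matrix (Fin 2) (Fin 2) ℂ) :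
    tensorOp A * tensorOp B = tensorOp (A * B) := by
  ext x y
  simp only [tensorOp, Matrix.of_apply, Matrix.mul_apply, Pi.mul_apply, ← Finset.prod_mul_distrib]
  rw [Finset.prod_univ_sum]
  simp [Fintype.piFinset_univ]

theorem pauliOp_eq_tensorOp {n : ℕ} (P : Fin n → Pauli) :
    pauliOp P = tensorOp fun i => (P i).toMatrix := rfl

theorem qubitOp_apply {n : ℕ} (i : Fin n) (A : Matrix (Fin 2) (Fin 2) ℂ) (x y : Qubits n) :
    qubitOp i A x y = if ∀ j, j ≠ i → x j = y j then A (x i) (y i) else 0 := by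
  simp only [qubitOp, tensorOp, Matrix.of_apply]
  rw [← Finset.mul_prod_erase _ _ (Finset.mem_univ i)]
  have h : ∀ j ∈ Finset.univ.erase i,
      Function.update (1 : Fin n → Matrix (Fin 2) (Fin 2) ℂ) i A j (x j) (y j) =
        if x j = y j then 1 else 0 := by
    intro j hj
    rw [Function.update_of_ne (Finset.ne_of_mem_erase hj)]
    simp [Matrix.one_apply]
  rw [Finset.prod_congr rfl h, Finset.prod_ite_zero]
  simp

theorem qubitOp_one {n : ℕ} (i : Fin n) : qubitOp i 1 = (1 : Op n) := by
  rw [qubitOp, ← tensorOp_one]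
  congr 1
  exact Function.update_eq_self i 1

theorem qubitOp_mul {n : ℕ} (i : Fin n) (A B : Matrix (Fin 2) (Fin 2) ℂ) :
    qubitOp i A * qubitOp i B = qubitOp i (A * B) := by
  rw [qubitOp, qubitOp, tensorOp_mul, ← Function.update_mul, one_mul, qubitOp]

theorem qubitOp_conjTranspose {n : ℕ} (i : Fin n) (A : Matrix (Fin 2) (Fin 2) ℂ) :
    (qubitOp i A)ᴴ = qubitOp i Aᴴ := by
  ext x y
  simp only [Matrix.conjTranspose_apply, qubitOp_apply, eq_comm (a := y _), apply_ite star, star_zero]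

theorem qubitOp_add {n : ℕ} (i : Fin n) (A B : Matrix (Fin 2) (Fin 2) ℂ) :
    qubitOp i (A + B) = qubitOp i A + qubitOp i B := by
  ext x y
  simp only [qubitOp_apply, Matrix.add_apply]
  split_ifs <;> simp

theorem qubitOp_smul {n : ℕ} (i : Fin n) (c : ℂ) (A : Matrix (Fin 2) (Fin 2) ℂ) :
    qubitOp i (c • A) = c • qubitOp i A := by
  ext x y
  simp [qubitOp_apply]

theorem pauliOp_update {n : ℕ} (i : Fin n) (p : Pauli) :
    pauliOp (Function.update (fun _ => Pauli.I) i p) = qubitOp i p.toMatrix := by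
  rw [pauliOp_eq_tensorOp, qubitOp]
  congr 1
  funext j
  by_cases h : j = i
  · subst h; simp
  · simp [h, Pauli.toMatrix]

/-- The Pauli matrices are a basis of the `2 × 2` matrices, so arbitrary errors reduce to Pauli
errors by linearity. The coefficient of the identity is half the trace, the only part of an error
that survives between code projectors. -/
theorem matrix_eq_pauli_sum (A : Matrix (Fin 2) (Fin 2) ℂ) :
    A = ((A 0 0 + A 1 1) / 2) • 1 + ((A 0 1 + A 1 0) / 2) • Pauli.X.toMatrix +
      (Complex.I * (A 0 1 - A 1 0) / 2) • Pauli.Y.toMatrix +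
      ((A 0 0 - A 1 1) / 2) • Pauli.Z.toMatrix := by
  ext i j
  have hI := Complex.I_mul_I
  fin_cases i <;> fin_cases j <;> simp [Pauli.toMatrix] <;>
    first
    | (ring_nf; done)
    | linear_combination (1 / 2 * (A 0 1 - A 1 0)) * hI
    | linear_combination (-1 / 2 * (A 0 1 - A 1 0)) * hI

theorem pauli_mul_self (p : Pauli) : p.toMatrix * p.toMatrix = 1 := by
  cases p <;> simp [Pauli.toMatrix, Matrix.one_fin_two]

theorem pauli_conjTranspose (p : Pauli) : p.toMatrixᴴ = p.toMatrix := by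
  cases p <;> ext i j <;> fin_cases i <;> fin_cases j <;>
    simp [Pauli.toMatrix]

theorem pauliOp_mul_self {n : ℕ} (P : Fin n → Pauli) : pauliOp P * pauliOp P = 1 := by
  rw [pauliOp_eq_tensorOp, tensorOp_mul, ← tensorOp_one]
  congr 1
  funext i
  exact pauli_mul_self _

theorem sign_mul_self (a : Bool) : sign a * sign a = 1 := by
  cases a <;> simp [sign]

/-! ### Error detection by the four-qubit code. -/

/-- Single-qubit Pauli matrices that anticommute at one place make a single-qubit error
anticommute with a Pauli operator. -/
theorem qubitOp_anticommute {n : ℕ} (i : Fin n) (A : Matrix (Fin 2) (Fin 2) ℂ) (M : Fin n → Pauli)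
    (h : A * (M i).toMatrix = -((M i).toMatrix * A)) :
    qubitOp i A * pauliOp M = -(pauliOp M * qubitOp i A) := by
  rw [qubitOp, pauliOp_eq_tensorOp, tensorOp_mul, tensorOp_mul]
  ext x y
  simp only [tensorOp, Matrix.of_apply, Matrix.neg_apply]
  rw [← Finset.mul_prod_erase _ _ (Finset.mem_univ i),
    ← Finset.mul_prod_erase _ _ (Finset.mem_univ i), ← neg_mul]
  congr 1
  · simp [h]
  · refine Finset.prod_congr rfl fun j hj => ?_
    simp [Finset.ne_of_mem_erase hj]

theorem pauli_anticommute (p : Pauli) (hp : p ≠ .I) :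
    p.toMatrix * Pauli.X.toMatrix = -(Pauli.X.toMatrix * p.toMatrix) ∨
      p.toMatrix * Pauli.Z.toMatrix = -(Pauli.Z.toMatrix * p.toMatrix) := by
  cases p
  · exact absurd rfl hp
  · right; simp [Pauli.toMatrix]
  · left; simp [Pauli.toMatrix]
  · left; simp [Pauli.toMatrix]

theorem exists_anticommute (i : Fin 4) (p : Pauli) (hp : p ≠ .I) :
    ∃ M ∈ [xxxx, zzzz],
      qubitOp i p.toMatrix * pauliOp M = -(pauliOp M * qubitOp i p.toMatrix) := by
  rcases pauli_anticommute p hp with h | h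
  · exact ⟨xxxx, by simp, qubitOp_anticommute i _ _ h⟩
  · exact ⟨zzzz, by simp, qubitOp_anticommute i _ _ h⟩

theorem detects_single_pauli (i : Fin 4) (p : Pauli) (hp : p ≠ .I) :
    ∃ M ∈ [xxxx, zzzz],
      ¬ Commute (pauliOp (Function.update (fun _ => Pauli.I) i p)) (pauliOp M) := by
  obtain ⟨M, hM, h⟩ := exists_anticommute i p hp
  refine ⟨M, hM, fun hc => ?_⟩
  rw [pauliOp_update] at hc
  -- Operators that both commute and anticommute have product zero, which is impossible for two
  -- involutions.
  have h0 : qubitOp i p.toMatrix * pauliOp M = 0 := by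
    ext x y
    have := congrFun (congrFun (h.trans (congrArg Neg.neg hc.eq.symm)) x) y
    exact self_eq_neg.mp this
  have h1 : (1 : Op 4) = 0 := by
    calc (1 : Op 4) = qubitOp i p.toMatrix * (qubitOp i p.toMatrix * pauliOp M) * pauliOp M := by
          rw [← mul_assoc, qubitOp_mul, pauli_mul_self, qubitOp_one, one_mul, pauliOp_mul_self]
      _ = 0 := by rw [h0, mul_zero, zero_mul]
  exact one_ne_zero h1

/-- `X` and `Z` anticommute at each of four places, and the four signs cancel. -/
theorem commute_xxxx_zzzz : Commute (pauliOp xxxx) (pauliOp zzzz) := by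
  have h : ∀ x y : Fin 2, ((Pauli.X.toMatrix * Pauli.Z.toMatrix) x y) =
      -((Pauli.Z.toMatrix * Pauli.X.toMatrix) x y) := by
    intro x y
    fin_cases x <;> fin_cases y <;> simp [Pauli.toMatrix]
  rw [Commute, SemiconjBy, pauliOp_eq_tensorOp, pauliOp_eq_tensorOp, tensorOp_mul, tensorOp_mul]
  ext x y
  simp only [tensorOp, Matrix.of_apply, Pi.mul_apply, xxxx, zzzz, Fin.prod_univ_four, h]
  ring

theorem pauliProj_mul_self {n : ℕ} (P : Fin n → Pauli) (a : Bool) :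
    pauliProj P a * pauliProj P a = pauliProj P a := by
  simp only [pauliProj, smul_mul_smul_comm, mul_add, add_mul, one_mul, mul_one,
    pauliOp_mul_self, sign_mul_self]
  module

theorem pauliProj_mul_of_ne {n : ℕ} (P : Fin n → Pauli) {a b : Bool} (h : a ≠ b) :
    pauliProj P a * pauliProj P b = 0 := by
  have hs : sign b = - sign a := by cases a <;> cases b <;> simp_all [sign]
  simp only [pauliProj, smul_mul_smul_comm, mul_add, add_mul, one_mul, mul_one,
    pauliOp_mul_self, sign_mul_self, hs, mul_neg]
  module

/-- An operator anticommuting with `P` maps each eigenspace of `P` into the opposite one. -/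
theorem pauliProj_mul_anticommute {n : ℕ} (P : Fin n → Pauli) (a : Bool) (E : Op n)
    (h : E * pauliOp P = -(pauliOp P * E)) : pauliProj P a * E * pauliProj P a = 0 := by
  have h2 : pauliOp P * E * pauliOp P = -E := by
    rw [mul_assoc, h, mul_neg, ← mul_assoc, pauliOp_mul_self, one_mul]
  simp only [pauliProj, smul_mul_assoc, mul_smul_comm, mul_add, add_mul, one_mul, mul_one,
    h2, h]
  have := sign_mul_self a
  match_scalars <;> first | (ring_nf; done) | linear_combination (-1 / 4) * this

/-- The projector onto the joint eigenspace of `XXXX` and `ZZZZ` with results `a₁`, `a₂`. -/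
noncomputable def codeProj (a₁ a₂ : Bool) : Op 4 := pauliProj zzzz a₂ * pauliProj xxxx a₁

theorem commute_pauliProj {n : ℕ} {P Q : Fin n → Pauli} (h : Commute (pauliOp P) (pauliOp Q))
    (a b : Bool) : Commute (pauliProj P a) (pauliProj Q b) := by
  refine Commute.smul_left (Commute.smul_right ?_ _) _
  exact ((Commute.one_left _).add_left
    (((Commute.one_right _).add_right (h.smul_right _)).smul_left _))

theorem codeProj_eq (a₁ a₂ : Bool) : codeProj a₁ a₂ = pauliProj xxxx a₁ * pauliProj zzzz a₂ :=
  (commute_pauliProj commute_xxxx_zzzz a₁ a₂).eq.symm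

theorem codeProj_mul_self (a₁ a₂ : Bool) :
    codeProj a₁ a₂ * codeProj a₁ a₂ = codeProj a₁ a₂ := by
  nth_rewrite 2 [codeProj_eq]
  rw [codeProj, mul_assoc, ← mul_assoc (pauliProj xxxx a₁), pauliProj_mul_self,
    (commute_pauliProj commute_xxxx_zzzz a₁ a₂).eq, ← mul_assoc, pauliProj_mul_self]

/-- The four-qubit code detects single-qubit errors, with every syndrome. -/
theorem codeProj_mul_qubitOp (a₁ a₂ : Bool) (i : Fin 4) (A : Matrix (Fin 2) (Fin 2) ℂ) :
    codeProj a₁ a₂ * qubitOp i A * codeProj a₁ a₂ =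
      ((A 0 0 + A 1 1) / 2) • codeProj a₁ a₂ := by
  have key : ∀ p : Pauli, p ≠ .I →
      codeProj a₁ a₂ * qubitOp i p.toMatrix * codeProj a₁ a₂ = 0 := by
    intro p hp
    obtain ⟨M, hM, h⟩ := exists_anticommute i p hp
    simp only [List.mem_cons, List.not_mem_nil, or_false] at hM
    rcases hM with rfl | rfl
    -- The two factors of one projector are exchanged so that the generator anticommuting with the
    -- error stands next to it on both sides.
    · nth_rewrite 2 [codeProj_eq]
      have := pauliProj_mul_anticommute xxxx a₁ _ h
      calc _ = pauliProj zzzz a₂ * (pauliProj xxxx a₁ * qubitOp i p.toMatrix * pauliProj xxxx a₁)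
            * pauliProj zzzz a₂ := by simp only [codeProj, mul_assoc]
        _ = 0 := by rw [this]; simp
    · nth_rewrite 1 [codeProj_eq]
      have := pauliProj_mul_anticommute zzzz a₂ _ h
      calc _ = pauliProj xxxx a₁ * (pauliProj zzzz a₂ * qubitOp i p.toMatrix * pauliProj zzzz a₂)
            * pauliProj xxxx a₁ := by simp only [codeProj, mul_assoc]
        _ = 0 := by rw [this]; simp
  conv_lhs => rw [matrix_eq_pauli_sum A]
  simp only [qubitOp_add, qubitOp_smul, mul_add, add_mul, mul_smul_comm, smul_mul_assoc,
    qubitOp_one, mul_one, codeProj_mul_self, key _ (by simp : Pauli.X ≠ .I),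
    key _ (by simp : Pauli.Y ≠ .I), key _ (by simp : Pauli.Z ≠ .I), smul_zero, add_zero]

/-! ### An explicit decoder; its integer entries, free of the factor `1/√2`, allow finite checks. -/

/-- A measurement result as a bit. -/
def bit (a : Bool) : Fin 2 := if a then 1 else 0

/-- The sign `(-1)^b`. -/
def bitSign (b : Fin 2) : ℤ := if b = 0 then 1 else -1

/-- The entries of `√2` times the decoding operation of the four-qubit code. -/
def decoderEntry (a₁ a₂ : Bool) (y x : Qubits 4) : ℤ :=
  if y 0 = x 0 + x 3 ∧ y 1 = x 1 + x 3 ∧ y 2 = x 0 + x 1 + x 2 + x 3 + bit a₂ then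
    bitSign (x 3 * (y 3 + bit a₁))
  else 0

/-- The decoding operation: controlled-not gates from the last qubit to the first two and a parity
gate onto the third, then a Hadamard gate on the last qubit, and bit flips for the syndrome. -/
noncomputable def decoder (a₁ a₂ : Bool) : Op 4 :=
  ((√2 : ℝ) : ℂ)⁻¹ • (Matrix.of (decoderEntry a₁ a₂)).map (Int.cast : ℤ → ℂ)

theorem decoderEntry_mul_transpose (a₁ a₂ : Bool) :
    Matrix.of (decoderEntry a₁ a₂) * (Matrix.of (decoderEntry a₁ a₂))ᵀ =
      Matrix.diagonal fun _ => 2 := by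
  have h₀ : ∀ x y : Qubits 4, ∑ z, decoderEntry false false x z * decoderEntry false false y z =
      if x = y then 2 else 0 := by
    decide +kernel
  -- The syndrome only flips output bits `2` and `3`, a permutation of the rows, so orthogonality
  -- for the zero syndrome gives it for all.
  have hshift : ∀ (a₁ a₂ : Bool) (x z : Qubits 4), decoderEntry a₁ a₂ x z =
      decoderEntry false false (x + ![0, 0, bit a₂, bit a₁]) z := by
    decide +kernel
  have h : ∀ x y : Qubits 4, ∑ z, decoderEntry a₁ a₂ x z * decoderEntry a₁ a₂ y z =
      if x = y then 2 else 0 := by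
    intro x y
    simp only [hshift a₁ a₂, h₀, add_left_inj]
  ext x y
  simp only [Matrix.mul_apply, Matrix.of_apply, Matrix.transpose_apply, h, Matrix.diagonal_apply]

/-- The entries are real. Bob's decoder acts on amplitudes by its transpose, so this is why the same
operation serves both parties: his transpose is the inverse of hers. -/
theorem decoder_conjTranspose (a₁ a₂ : Bool) : (decoder a₁ a₂)ᴴ = (decoder a₁ a₂)ᵀ := by
  ext x y
  simp [decoder, Matrix.conjTranspose_apply]

theorem decoder_mul_transpose (a₁ a₂ : Bool) : decoder a₁ a₂ * (decoder a₁ a₂)ᵀ = 1 := by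
  have h := congrArg (fun M : Matrix (Qubits 4) (Qubits 4) ℤ => M.map (Int.castRingHom ℂ))
    (decoderEntry_mul_transpose a₁ a₂)
  simp only [Matrix.map_mul] at h
  have h2 : (((√2 : ℝ) : ℂ)⁻¹ * ((√2 : ℝ) : ℂ)⁻¹) * 2 = 1 := by
    rw [← mul_inv, ← Complex.ofReal_mul, Real.mul_self_sqrt (by norm_num)]
    norm_num
  rw [Matrix.diagonal_map (by simp)] at h
  have h3 : Matrix.diagonal (fun _ => Int.castRingHom ℂ 2) = (2 : ℂ) • (1 : Op 4) := by
    rw [Matrix.smul_one_eq_diagonal]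
    simp
  rw [h3] at h
  rw [decoder, Matrix.transpose_smul, smul_mul_smul_comm]
  calc _ = (((√2 : ℝ) : ℂ)⁻¹ * ((√2 : ℝ) : ℂ)⁻¹) • ((2 : ℂ) • (1 : Op 4)) := by rw [← h]; rfl
    _ = 1 := by rw [smul_smul, h2, one_smul]

theorem decoder_mem_unitaryGroup (a₁ a₂ : Bool) :
    decoder a₁ a₂ ∈ Matrix.unitaryGroup (Qubits 4) ℂ := by
  rw [Matrix.mem_unitaryGroup_iff, Matrix.star_eq_conjTranspose, decoder_conjTranspose,
    decoder_mul_transpose]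

theorem mul_pauliOp_xxxx_apply (M : Op 4) (y x : Qubits 4) :
    (M * pauliOp xxxx) y x = M y (fun i => x i + 1) := by
  have hX : ∀ s t : Fin 2, Pauli.X.toMatrix s t = if s = t + 1 then 1 else 0 := by
    intro s t; fin_cases s <;> fin_cases t <;> simp [Pauli.toMatrix]
  rw [Matrix.mul_apply, Finset.sum_eq_single (fun i => x i + 1)]
  · simp [pauliOp, xxxx, hX]
  · intro z _ hz
    obtain ⟨i, hi⟩ := Function.ne_iff.mp hz
    simp only [pauliOp, Matrix.of_apply, xxxx, hX]
    rw [Finset.prod_eq_zero (Finset.mem_univ i) (if_neg hi), mul_zero]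
  · simp

theorem mul_pauliOp_zzzz_apply (M : Op 4) (y x : Qubits 4) :
    (M * pauliOp zzzz) y x = M y x * (bitSign (x 0 + x 1 + x 2 + x 3) : ℤ) := by
  have hZ : ∀ s t : Fin 2, Pauli.Z.toMatrix s t = if s = t then (bitSign s : ℂ) else 0 := by
    intro s t; fin_cases s <;> fin_cases t <;> simp [Pauli.toMatrix, bitSign]
  have hs : ∀ a b c d : Fin 2, bitSign a * bitSign b * bitSign c * bitSign d =
      bitSign (a + b + c + d) := by decide
  rw [Matrix.mul_apply, Finset.sum_eq_single x]
  · simp [pauliOp, zzzz, hZ, Fin.prod_univ_four, ← hs]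
  · intro z _ hz
    obtain ⟨i, hi⟩ := Function.ne_iff.mp hz
    simp only [pauliOp, Matrix.of_apply, zzzz, hZ]
    rw [Finset.prod_eq_zero (Finset.mem_univ i) (if_neg hi), mul_zero]
  · simp

theorem sign_eq_bitSign (a : Bool) : sign a = (bitSign (bit a) : ℤ) := by
  cases a <;> simp [sign, bitSign, bit]

/-- The projector onto the states whose qubit `i` is `|0⟩`. -/
def zeroProj (i : Fin 4) : Op 4 := Matrix.diagonal fun y => if y i = 0 then 1 else 0

/-- The decoder conjugates `XXXX` into `Z` on qubit `3`, up to the sign of the result; likewise it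
sends `ZZZZ` to qubit `2` below. -/
theorem decoder_mul_pauliProj_xxxx (a₁ a₂ : Bool) :
    decoder a₁ a₂ * pauliProj xxxx a₁ = zeroProj 3 * decoder a₁ a₂ := by
  have h : ∀ (a₁ a₂ : Bool) (y x : Qubits 4), decoderEntry a₁ a₂ y x + bitSign (bit a₁) *
      decoderEntry a₁ a₂ y (fun i => x i + 1) =
      2 * ((if y 3 = 0 then 1 else 0) * decoderEntry a₁ a₂ y x) := by
    decide +kernel
  ext y x
  have h' := congrArg (Int.cast : ℤ → ℂ) (h a₁ a₂ y x)
  push_cast at h'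
  rw [pauliProj, Matrix.mul_smul, mul_add, mul_one, Matrix.mul_smul, Matrix.smul_apply,
    Matrix.add_apply, Matrix.smul_apply, mul_pauliOp_xxxx_apply, zeroProj, Matrix.diagonal_mul,
    sign_eq_bitSign]
  simp only [decoder, Matrix.smul_apply, Matrix.map_apply, Matrix.of_apply, smul_eq_mul]
  linear_combination (1 / 2 * ((√2 : ℝ) : ℂ)⁻¹) * h'

theorem decoder_mul_pauliProj_zzzz (a₁ a₂ : Bool) :
    decoder a₁ a₂ * pauliProj zzzz a₂ = zeroProj 2 * decoder a₁ a₂ := by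
  have h : ∀ (a₁ a₂ : Bool) (y x : Qubits 4), decoderEntry a₁ a₂ y x + bitSign (bit a₂) *
      (decoderEntry a₁ a₂ y x * bitSign (x 0 + x 1 + x 2 + x 3)) =
      2 * ((if y 2 = 0 then 1 else 0) * decoderEntry a₁ a₂ y x) := by
    decide +kernel
  ext y x
  have h' := congrArg (Int.cast : ℤ → ℂ) (h a₁ a₂ y x)
  push_cast at h'
  rw [pauliProj, Matrix.mul_smul, mul_add, mul_one, Matrix.mul_smul, Matrix.smul_apply,
    Matrix.add_apply, Matrix.smul_apply, mul_pauliOp_zzzz_apply, zeroProj, Matrix.diagonal_mul,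
    sign_eq_bitSign]
  simp only [decoder, Matrix.smul_apply, Matrix.map_apply, Matrix.of_apply, smul_eq_mul]
  linear_combination (1 / 2 * ((√2 : ℝ) : ℂ)⁻¹) * h'

/-- The projector onto the states whose last two of four qubits are `|00⟩`. -/
def ancillaProj : Op 4 := Matrix.diagonal fun y => if y 2 = 0 ∧ y 3 = 0 then 1 else 0

theorem decoder_mul_codeProj (a₁ a₂ : Bool) :
    decoder a₁ a₂ * codeProj a₁ a₂ = ancillaProj * decoder a₁ a₂ := by
  have h : ancillaProj = zeroProj 2 * zeroProj 3 := by
    rw [zeroProj, zeroProj, Matrix.diagonal_mul_diagonal, ancillaProj]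
    congr 1
    funext y
    split_ifs <;> simp_all
  rw [codeProj, ← mul_assoc, decoder_mul_pauliProj_zzzz, mul_assoc, decoder_mul_pauliProj_xxxx,
    ← mul_assoc, h]

theorem decoder_mul_codeProj_mul_transpose (a₁ a₂ : Bool) :
    decoder a₁ a₂ * codeProj a₁ a₂ * (decoder a₁ a₂)ᵀ = ancillaProj := by
  rw [decoder_mul_codeProj, mul_assoc, decoder_mul_transpose, mul_one]

/-! ### Syndrome spaces as ranges of the code projectors. -/

theorem pauliProj_mulVec_eq_iff {n : ℕ} (P : Fin n → Pauli) (a : Bool) (ψ : Qubits n → ℂ) :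
    pauliProj P a *ᵥ ψ = ψ ↔ pauliOp P *ᵥ ψ = sign a • ψ := by
  have hs := sign_mul_self a
  rw [pauliProj, Matrix.smul_mulVec, Matrix.add_mulVec, Matrix.one_mulVec, Matrix.smul_mulVec]
  constructor
  · intro h
    funext x
    have := congrFun h x
    simp only [Pi.smul_apply, Pi.add_apply, smul_eq_mul] at this ⊢
    linear_combination (2 * sign a) * this - (pauliOp P *ᵥ ψ) x * hs
  · intro h
    rw [h, smul_smul, hs]
    module

theorem mem_syndromeSpace_iff (a₁ a₂ : Bool) (ψ : Qubits 4 → ℂ) :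
    ψ ∈ syndromeSpace [(xxxx, a₁), (zzzz, a₂)] ↔ codeProj a₁ a₂ *ᵥ ψ = ψ := by
  have h : ψ ∈ syndromeSpace [(xxxx, a₁), (zzzz, a₂)] ↔
      pauliProj xxxx a₁ *ᵥ ψ = ψ ∧ pauliProj zzzz a₂ *ᵥ ψ = ψ := by
    rw [pauliProj_mulVec_eq_iff, pauliProj_mulVec_eq_iff]
    simp [syndromeSpace]
  rw [h]
  constructor
  · rintro ⟨h1, h2⟩
    rw [codeProj, ← Matrix.mulVec_mulVec, h1, h2]
  · intro h0
    constructor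
    · rw [← h0, Matrix.mulVec_mulVec, codeProj_eq, ← mul_assoc, pauliProj_mul_self]
    · rw [← h0, Matrix.mulVec_mulVec, codeProj, ← mul_assoc, pauliProj_mul_self]

theorem isDecoding_decoder (a₁ a₂ : Bool) (h : 2 ≤ 4) :
    IsDecoding [(xxxx, a₁), (zzzz, a₂)] (Fin.castLEEmb h) (decoder a₁ a₂) := by
  refine ⟨decoder_mem_unitaryGroup a₁ a₂, fun ψ hψ x hx => ?_⟩
  rw [mem_syndromeSpace_iff] at hψ
  rw [← hψ, Matrix.mulVec_mulVec, decoder_mul_codeProj, ← Matrix.mulVec_mulVec, ancillaProj,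
    Matrix.mulVec_diagonal, if_neg, zero_mul]
  obtain ⟨i, hi, hx⟩ := hx
  have h0 := hi 0
  have h1 := hi 1
  rintro ⟨h2, h3⟩
  fin_cases i
  · exact h0 rfl
  · exact h1 rfl
  · exact hx h2
  · exact hx h3

/-- The dimension is the rank of the code projector, unchanged by conjugation with the decoder,
which makes it diagonal with four ones. -/
theorem finrank_syndromeSpace (a₁ a₂ : Bool) :
    Module.finrank ℂ (syndromeSpace [(xxxx, a₁), (zzzz, a₂)]) = 2 ^ 2 := by
  have h : syndromeSpace [(xxxx, a₁), (zzzz, a₂)] =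
      LinearMap.range (codeProj a₁ a₂).mulVecLin := by
    ext ψ
    rw [mem_syndromeSpace_iff, LinearMap.mem_range]
    constructor
    · exact fun h => ⟨ψ, h⟩
    · rintro ⟨φ, rfl⟩
      rw [Matrix.mulVecLin_apply, Matrix.mulVec_mulVec, codeProj_mul_self]
  have hU : IsUnit (decoder a₁ a₂).det := by
    rw [← Matrix.isUnit_iff_isUnit_det]
    exact IsUnit.of_mul_eq_one _ (decoder_mul_transpose a₁ a₂)
  have hcard : Fintype.card {y : Qubits 4 // y 2 = 0 ∧ y 3 = 0} = 4 := by decide +kernel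
  rw [h, show Module.finrank ℂ (LinearMap.range (codeProj a₁ a₂).mulVecLin) =
    (codeProj a₁ a₂).rank from rfl,
    ← Matrix.rank_mul_eq_right_of_isUnit_det _ (codeProj a₁ a₂) hU,
    ← Matrix.rank_mul_eq_left_of_isUnit_det (decoder a₁ a₂)ᵀ _ (by rwa [Matrix.det_transpose]),
    decoder_mul_codeProj_mul_transpose, ancillaProj, Matrix.rank_diagonal]
  simp only [ne_eq, ite_eq_right_iff, one_ne_zero, imp_false, not_not]
  rw [hcard]
  norm_num

/-! ### Splitting off a subset of the qubits. -/

/-- Labels of the qubits outside the range of `e`. -/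
abbrev Rest {m n : ℕ} (e : Fin m ↪ Fin n) : Type := {i : Fin n // ∀ j, e j ≠ i}

/-- Split the qubits into those selected by `e` and the others. -/
noncomputable def splitQubits {m n : ℕ} (e : Fin m ↪ Fin n) :
    Qubits n ≃ Qubits m × (Rest e → Fin 2) where
  toFun x := (fun j => x (e j), fun i => x i)
  invFun p i := open Classical in
    if h : ∃ j, e j = i then p.1 h.choose else p.2 ⟨i, not_exists.mp h⟩
  left_inv x := by
    funext i
    by_cases h : ∃ j, e j = i
    · simp only [dif_pos h, h.choose_spec]
    · simp only [dif_neg h]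
  right_inv p := by
    refine Prod.ext (funext fun j => ?_) (funext fun i => ?_)
    · have h : ∃ j', e j' = e j := ⟨j, rfl⟩
      have h2 : h.choose = j := e.injective h.choose_spec
      simp only [dif_pos h, h2]
    · have h : ¬ ∃ j, e j = i := not_exists.mpr i.2
      simp only [dif_neg h, Subtype.coe_eta]

theorem splitQubits_apply {m n : ℕ} (e : Fin m ↪ Fin n) (x : Qubits n) :
    splitQubits e x = (fun j => x (e j), fun i : Rest e => x i) := rfl

theorem splitQubits_symm_apply {m n : ℕ} (e : Fin m ↪ Fin n) (p : Qubits m)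
    (r : Rest e → Fin 2) (j : Fin m) : (splitQubits e).symm (p, r) (e j) = p j :=
  congrFun (congrArg Prod.fst ((splitQubits e).apply_symm_apply (p, r))) j

theorem splitQubits_symm_apply_rest {m n : ℕ} (e : Fin m ↪ Fin n) (p : Qubits m)
    (r : Rest e → Fin 2) (i : Rest e) : (splitQubits e).symm (p, r) i = r i :=
  congrFun (congrArg Prod.snd ((splitQubits e).apply_symm_apply (p, r))) i

/-- The operator that acts as `B` on the qubits outside the range of `e`. -/
noncomputable def restOn {m n : ℕ} (e : Fin m ↪ Fin n)
    (B : Matrix (Rest e → Fin 2) (Rest e → Fin 2) ℂ) : Op n :=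
  ((1 : Op m) ⊗ₖ B).submatrix (splitQubits e) (splitQubits e)

section actOn

variable {m n : ℕ} (e : Fin m ↪ Fin n)

theorem actOn_eq_submatrix (A : Op m) :
    actOn e A = (A ⊗ₖ (1 : Matrix (Rest e → Fin 2) (Rest e → Fin 2) ℂ)).submatrix
      (splitQubits e) (splitQubits e) := by
  ext x y
  simp only [actOn, Matrix.of_apply, Matrix.submatrix_apply, splitQubits_apply,
    Matrix.kroneckerMap_apply, Matrix.one_apply, mul_ite, mul_one, mul_zero, funext_iff,
    Subtype.forall]

theorem actOn_mul (A B : Op m) : actOn e (A * B) = actOn e A * actOn e B := by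
  simp only [actOn_eq_submatrix]
  rw [Matrix.submatrix_mul_equiv, ← Matrix.mul_kronecker_mul, one_mul]

theorem actOn_one : actOn e (1 : Op m) = 1 := by
  rw [actOn_eq_submatrix, Matrix.one_kronecker_one, Matrix.submatrix_one_equiv]

theorem actOn_zero : actOn e (0 : Op m) = 0 := by
  ext x y
  simp [actOn]

theorem actOn_add (A B : Op m) : actOn e (A + B) = actOn e A + actOn e B := by
  ext x y
  simp only [actOn, Matrix.of_apply, Matrix.add_apply]
  split_ifs <;> simp

theorem actOn_smul (c : ℂ) (A : Op m) : actOn e (c • A) = c • actOn e A := by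
  ext x y
  simp [actOn]

theorem actOn_transpose (A : Op m) : (actOn e A)ᵀ = actOn e Aᵀ := by
  ext x y
  simp only [actOn, Matrix.of_apply, Matrix.transpose_apply, eq_comm (a := y _)]

theorem actOn_conjTranspose (A : Op m) : (actOn e A)ᴴ = actOn e Aᴴ := by
  ext x y
  simp only [actOn, Matrix.of_apply, Matrix.conjTranspose_apply, eq_comm (a := y _),
    apply_ite star, star_zero]

theorem actOn_mem_unitaryGroup {U : Op m} (hU : U ∈ Matrix.unitaryGroup (Qubits m) ℂ) :
    actOn e U ∈ Matrix.unitaryGroup (Qubits n) ℂ := by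
  rw [Matrix.mem_unitaryGroup_iff, Matrix.star_eq_conjTranspose] at hU ⊢
  rw [actOn_conjTranspose, ← actOn_mul, hU, actOn_one]

theorem actOn_mul_restOn (A : Op m) (B : Matrix (Rest e → Fin 2) (Rest e → Fin 2) ℂ) :
    actOn e A * restOn e B = (A ⊗ₖ B).submatrix (splitQubits e) (splitQubits e) := by
  rw [actOn_eq_submatrix, restOn, Matrix.submatrix_mul_equiv, ← Matrix.mul_kronecker_mul,
    mul_one, one_mul]

theorem commute_actOn_restOn (A : Op m) (B : Matrix (Rest e → Fin 2) (Rest e → Fin 2) ℂ) :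
    Commute (actOn e A) (restOn e B) := by
  rw [Commute, SemiconjBy, actOn_mul_restOn, actOn_eq_submatrix, restOn,
    Matrix.submatrix_mul_equiv, ← Matrix.mul_kronecker_mul, mul_one, one_mul]

theorem restOn_smul_one (c : ℂ) : restOn e (c • 1) = c • (1 : Op n) := by
  rw [restOn, Matrix.kronecker_smul, Matrix.one_kronecker_one, Matrix.submatrix_smul,
    Pi.smul_apply, Pi.smul_apply, Matrix.submatrix_one_equiv]

theorem exists_actOn_eq_restOn {l : ℕ} (f : Fin l ↪ Fin n) (h : ∀ i j, f i ≠ e j) (N : Op l) :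
    ∃ B, actOn f N = restOn e B := by
  have hf : ∀ i, ∀ j, e j ≠ f i := fun i j => (h i j).symm
  refine ⟨Matrix.of fun r s => if ∀ i : Rest e, (∀ j, f j ≠ i) → r i = s i then
    N (fun i => r ⟨f i, hf i⟩) (fun i => s ⟨f i, hf i⟩) else 0, ?_⟩
  ext x y
  simp only [actOn, restOn, Matrix.of_apply, Matrix.submatrix_apply, splitQubits_apply,
    Matrix.kroneckerMap_apply, Matrix.one_apply]
  have hiff : (∀ i, (∀ j, f j ≠ i) → x i = y i) ↔
      ((fun j => x (e j)) = fun j => y (e j)) ∧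
        ∀ i : Rest e, (∀ j, f j ≠ i) → x i = y i := by
    constructor
    · exact fun H => ⟨funext fun j => H _ fun i => h i j, fun i => H i⟩
    · rintro ⟨H1, H2⟩ i hi
      by_cases hie : ∃ j, e j = i
      · obtain ⟨j, rfl⟩ := hie
        exact congrFun H1 j
      · exact H2 ⟨i, not_exists.mp hie⟩ hi
  rw [ite_mul, one_mul, zero_mul, if_congr hiff rfl rfl, ite_and]

end actOn

/-! ### Pure states of pairs -/

/-- The unnormalized state with amplitudes `M x y`. -/
def pureState {n : ℕ} (M : Op n) : PairOp n :=
  Matrix.of fun p q => M p.1 p.2 * star (M q.1 q.2)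

theorem pureState_eq_vecMulVec {n : ℕ} (M : Op n) :
    pureState M = Matrix.vecMulVec (Matrix.vec Mᵀ) (star (Matrix.vec Mᵀ)) := rfl

/-- This is the identity `(A ⊗ B) vec M = vec (A M Bᵀ)` in the convention used here; it replaces all
later computation on density matrices by products of operators on `n` qubits. -/
theorem kronecker_conj_pureState {n : ℕ} (A B M : Op n) :
    (A ⊗ₖ B) * pureState M * (A ⊗ₖ B)ᴴ = pureState (A * M * Bᵀ) := by
  rw [pureState_eq_vecMulVec, pureState_eq_vecMulVec, Matrix.mul_vecMulVec,
    Matrix.vecMulVec_mul, ← Matrix.star_mulVec, Matrix.kronecker_mulVec_vec]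
  simp only [Matrix.transpose_mul, Matrix.transpose_transpose, mul_assoc]

theorem eprState_eq_smul_pureState (n : ℕ) :
    eprState n = ((2 : ℂ) ^ n)⁻¹ • pureState 1 := by
  ext p q
  simp only [eprState, pureState, Matrix.of_apply, Matrix.smul_apply, Matrix.one_apply,
    smul_eq_mul, apply_ite star, star_one, star_zero, ite_and]
  split_ifs <;> simp

theorem keepPairs_add {n k : ℕ} (keep : Fin k ↪ Fin n) (ρ σ : PairOp n) :
    keepPairs keep (ρ + σ) = keepPairs keep ρ + keepPairs keep σ := by
  ext p q
  simp only [keepPairs, Matrix.of_apply, Matrix.add_apply, ← Finset.sum_add_distrib]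
  refine Finset.sum_congr rfl fun x _ => Finset.sum_congr rfl fun y _ => ?_
  split_ifs <;> simp

theorem keepPairs_smul {n k : ℕ} (keep : Fin k ↪ Fin n) (c : ℂ) (ρ : PairOp n) :
    keepPairs keep (c • ρ) = c • keepPairs keep ρ := by
  ext p q
  simp only [keepPairs, Matrix.of_apply, Matrix.smul_apply, smul_eq_mul, Finset.mul_sum,
    mul_ite, mul_zero]

/-- States are left unnormalized, so both sides of the final condition are linear in `ρ`. With
additivity, this reduces a channel to its single Kraus operators. -/
theorem Protocol.AlwaysPerfect.smul {n k : ℕ} {P : Protocol n k} (c : ℂ) {ρ : PairOp n}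
    (h : P.AlwaysPerfect ρ) : P.AlwaysPerfect (c • ρ) := by
  induction P generalizing ρ with
  | measure M next ih =>
    intro a b
    rw [Matrix.mul_smul, Matrix.smul_mul]
    exact ih a b (h a b)
  | finish UA UB keep =>
    simp only [Protocol.AlwaysPerfect] at h ⊢
    rw [Matrix.mul_smul, Matrix.smul_mul, keepPairs_smul, h, Matrix.trace_smul, smul_assoc]

theorem Protocol.AlwaysPerfect.add {n k : ℕ} {P : Protocol n k} {ρ σ : PairOp n}
    (hρ : P.AlwaysPerfect ρ) (hσ : P.AlwaysPerfect σ) : P.AlwaysPerfect (ρ + σ) := by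
  induction P generalizing ρ σ with
  | measure M next ih =>
    intro a b
    rw [mul_add, add_mul]
    exact ih a b (hρ a b) (hσ a b)
  | finish UA UB keep =>
    simp only [Protocol.AlwaysPerfect] at hρ hσ ⊢
    rw [mul_add, add_mul, keepPairs_add, hρ, hσ, Matrix.trace_add, add_smul]

theorem Protocol.AlwaysPerfect.zero {n k : ℕ} (P : Protocol n k) : P.AlwaysPerfect 0 := by
  induction P with
  | measure M next ih =>
    intro a b
    rw [mul_zero, zero_mul]
    exact ih a b
  | finish UA UB keep =>
    have h := keepPairs_smul keep 0 0
    rw [zero_smul, zero_smul] at h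
    rw [Protocol.AlwaysPerfect, mul_zero, zero_mul, h, Matrix.trace_zero, zero_smul]

theorem Protocol.AlwaysPerfect.sum {n k : ℕ} {P : Protocol n k} {ι : Type*} (s : Finset ι)
    {ρ : ι → PairOp n} (h : ∀ i, P.AlwaysPerfect (ρ i)) :
    P.AlwaysPerfect (∑ i ∈ s, ρ i) := by
  classical
  induction s using Finset.induction_on with
  | empty =>
    exact .zero P
  | insert i s hi ih =>
    rw [Finset.sum_insert hi]
    exact (h i).add ih

/-- Discarding pairs is a partial trace. -/
theorem keepPairs_apply {n k : ℕ} (keep : Fin k ↪ Fin n) (ρ : PairOp n)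
    (p q : Qubits k × Qubits k) :
    keepPairs keep ρ p q = ∑ r : (Rest keep → Fin 2) × (Rest keep → Fin 2),
      ρ ((splitQubits keep).symm (p.1, r.1), (splitQubits keep).symm (p.2, r.2))
        ((splitQubits keep).symm (q.1, r.1), (splitQubits keep).symm (q.2, r.2)) := by
  have key : ∀ (x : Qubits n) (u : Qubits k) (r : Rest keep → Fin 2),
      (∀ j, x (keep j) = u j) → (∀ i : Rest keep, x i = r i) →
        (splitQubits keep).symm (u, r) = x := by
    intro x u r h1 h2
    rw [Equiv.symm_apply_eq, splitQubits_apply]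
    exact Prod.ext (funext fun j => (h1 j).symm) (funext fun i => (h2 i).symm)
  rw [keepPairs, Matrix.of_apply, ← Fintype.sum_prod_type', ← Finset.sum_filter]
  symm
  refine Finset.sum_bij'
    (fun r _ => (((splitQubits keep).symm (p.1, r.1), (splitQubits keep).symm (p.2, r.2)),
      ((splitQubits keep).symm (q.1, r.1), (splitQubits keep).symm (q.2, r.2))))
    (fun z _ => (fun i => z.1.1 i, fun i => z.1.2 i)) ?_ ?_ ?_ ?_ ?_
  · intro r _
    rw [Finset.mem_filter]
    refine ⟨Finset.mem_univ _, fun j => ?_, fun i hi => ?_⟩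
    · simp only [splitQubits_symm_apply, and_self]
    · have h := fun u s => splitQubits_symm_apply_rest keep u s ⟨i, hi⟩
      simp only at h
      simp only [h, and_self]
  · simp
  · intro r _
    simp only [splitQubits_symm_apply_rest]
  · rintro ⟨⟨x1, x2⟩, y1, y2⟩ hz
    obtain ⟨-, h1, h2⟩ := Finset.mem_filter.mp hz
    simp only at h1 h2 ⊢
    rw [key x1 _ _ (fun j => (h1 j).1) (fun _ => rfl),
      key x2 _ _ (fun j => (h1 j).2.1) (fun _ => rfl),
      key y1 _ _ (fun j => (h1 j).2.2.1) (fun i => (h2 i i.2).1.symm),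
      key y2 _ _ (fun j => (h1 j).2.2.2) (fun i => (h2 i i.2).2.symm)]
  · intro r _
    rfl

/-- The operator is the tensor product of the identity on the qubits in `keep` with some
operator on the others. -/
def IsIdentityOn {n k : ℕ} (keep : Fin k ↪ Fin n) (M : Op n) : Prop :=
  ∃ g : (Rest keep → Fin 2) → (Rest keep → Fin 2) → ℂ, ∀ x y, M x y =
    if ∀ j, x (keep j) = y (keep j) then g (fun i => x i) (fun i => y i) else 0

/-- Amplitudes `1 ⊗ g` describe a product of EPR pairs on `keep` with a state `g` of the rest.
Discarding the rest leaves the factor `∑ |g|²`, while the full trace is `2 ^ k` times it, which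
cancels the normalization of `eprState`. -/
theorem keepPairs_pureState {n k : ℕ} (keep : Fin k ↪ Fin n) (M : Op n)
    (hM : IsIdentityOn keep M) :
    keepPairs keep (pureState M) = (pureState M).trace • eprState k := by
  obtain ⟨g, hg⟩ := hM
  have hg' : ∀ u v r s, M ((splitQubits keep).symm (u, r)) ((splitQubits keep).symm (v, s)) =
      if u = v then g r s else 0 := by
    intro u v r s
    simp only [hg, splitQubits_symm_apply, splitQubits_symm_apply_rest, funext_iff]
  have htr : (pureState M).trace =
      2 ^ k * ∑ r : (Rest keep → Fin 2) × (Rest keep → Fin 2), g r.1 r.2 * star (g r.1 r.2) := by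
    rw [Matrix.trace, ← ((splitQubits keep).prodCongr (splitQubits keep)).symm.sum_comp]
    simp only [Matrix.diag_apply, pureState, Matrix.of_apply, Fintype.sum_prod_type,
      Equiv.prodCongr_symm, Equiv.prodCongr_apply, Prod.map_apply, hg']
    have : ∀ (u : Qubits k) (r : Rest keep → Fin 2),
        ∑ v : Qubits k, ∑ s : Rest keep → Fin 2,
          (if u = v then g r s else 0) * star (if u = v then g r s else 0) =
        ∑ s : Rest keep → Fin 2, g r s * star (g r s) := by
      intro u r
      rw [Finset.sum_eq_single u (fun v _ hv => by simp [hv.symm]) (by simp)]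
      simp
    simp only [this, Finset.sum_const, Finset.card_univ, nsmul_eq_mul]
    simp
  ext p q
  rw [keepPairs_apply, Matrix.smul_apply, htr]
  simp only [pureState, Matrix.of_apply, hg', eprState, smul_eq_mul]
  by_cases hp : p.1 = p.2
  · by_cases hq : q.1 = q.2
    · simp only [hp, hq, if_true, and_self]
      field_simp
    · simp [hp, hq]
  · simp [hp]

theorem alwaysPerfect_finish_pureState {n k : ℕ} (keep : Fin k ↪ Fin n) {UA UB : Op n}
    (hA : UA ∈ Matrix.unitaryGroup (Qubits n) ℂ) (hB : UB ∈ Matrix.unitaryGroup (Qubits n) ℂ)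
    (M : Op n) (hM : IsIdentityOn keep (UA * M * UBᵀ)) :
    (Protocol.finish UA UB keep).AlwaysPerfect (pureState M) := by
  have h1 : (UA ⊗ₖ UB)ᴴ * (UA ⊗ₖ UB) = 1 := by
    rw [Matrix.conjTranspose_kronecker, ← Matrix.mul_kronecker_mul,
      ← Matrix.star_eq_conjTranspose, ← Matrix.star_eq_conjTranspose,
      Matrix.mem_unitaryGroup_iff'.mp hA, Matrix.mem_unitaryGroup_iff'.mp hB,
      Matrix.one_kronecker_one]
  have htr : ((UA ⊗ₖ UB) * pureState M * (UA ⊗ₖ UB)ᴴ).trace = (pureState M).trace := by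
    rw [mul_assoc, Matrix.trace_mul_comm, mul_assoc, h1, mul_one]
  simp only [Protocol.AlwaysPerfect]
  rw [← htr, kronecker_conj_pureState, keepPairs_pureState keep _ hM]

/-! ### The six-pair protocol. -/

theorem pauliOp_onFirstFour (P : Fin 4 → Pauli) (h : 4 ≤ 6) :
    pauliOp (onFirstFour P) = actOn (Fin.castLEEmb h) (pauliOp P) := by
  ext x y
  have hiff : (∀ i : Fin 6, (∀ j, Fin.castLEEmb h j ≠ i) → x i = y i) ↔ x 4 = y 4 ∧ x 5 = y 5 := by
    constructor
    · exact fun H => ⟨H 4 fun j => Fin.ne_of_lt (b := 4) j.2,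
        H 5 fun j => Fin.ne_of_lt (b := 5) (Nat.lt_succ_of_lt j.2)⟩
    · rintro ⟨h4, h5⟩ i hi
      fin_cases i
      · exact absurd rfl (hi 0)
      · exact absurd rfl (hi 1)
      · exact absurd rfl (hi 2)
      · exact absurd rfl (hi 3)
      · exact h4
      · exact h5
  simp only [actOn, Matrix.of_apply, hiff, pauliOp, Fin.prod_univ_six, Fin.prod_univ_four,
    onFirstFour]
  by_cases h4 : x 4 = y 4 <;> by_cases h5 : x 5 = y 5 <;>
    simp [h4, h5, Pauli.toMatrix, Matrix.one_apply]

theorem pauliProj_onFirstFour (P : Fin 4 → Pauli) (a : Bool) (h : 4 ≤ 6) :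
    pauliProj (onFirstFour P) a = actOn (Fin.castLEEmb h) (pauliProj P a) := by
  simp only [pauliProj, actOn_smul, actOn_add, actOn_one, pauliOp_onFirstFour P h]

/-- Bob's projectors act on amplitudes transposed; since `X` and `Z` are symmetric, they remain
projectors for his own results. -/
theorem pauliOp_xxxx_transpose : (pauliOp xxxx)ᵀ = pauliOp xxxx := by
  have h : ∀ s t, Pauli.X.toMatrix s t = Pauli.X.toMatrix t s := by
    intro s t; fin_cases s <;> fin_cases t <;> simp [Pauli.toMatrix]
  ext x y
  simp only [Matrix.transpose_apply, pauliOp, Matrix.of_apply, xxxx, h (y _)]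

theorem pauliOp_zzzz_transpose : (pauliOp zzzz)ᵀ = pauliOp zzzz := by
  have h : ∀ s t, Pauli.Z.toMatrix s t = Pauli.Z.toMatrix t s := by
    intro s t; fin_cases s <;> fin_cases t <;> simp [Pauli.toMatrix]
  ext x y
  simp only [Matrix.transpose_apply, pauliOp, Matrix.of_apply, zzzz, h (y _)]

theorem pauliProj_transpose {n : ℕ} (P : Fin n → Pauli) (a : Bool)
    (h : (pauliOp P)ᵀ = pauliOp P) : (pauliProj P a)ᵀ = pauliProj P a := by
  simp [pauliProj, h]

/-- The error is a single-qubit operator on the selected qubits, or acts on the others. -/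
theorem actOn_cases {m k n : ℕ} (e : Fin k ↪ Fin n) (hm : m ≤ 1) (f : Fin m ↪ Fin n)
    (N : Op m) : (∃ i A, actOn f N = actOn e (qubitOp i A)) ∨ ∃ B, actOn f N = restOn e B := by
  by_cases h : ∀ i j, f i ≠ e j
  · exact .inr (exists_actOn_eq_restOn e f h N)
  · left
    push Not at h
    obtain ⟨i, j, hij⟩ := h
    -- A point of `Fin m` exists and `m ≤ 1`, so the error acts on exactly one qubit.
    have hall : ∀ i', i' = i := fun i' => Fin.ext (by have := i.2; have := i'.2; omega)
    refine ⟨j, Matrix.of fun s t => N (fun _ => s) (fun _ => t), ?_⟩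
    ext x y
    have hx : ∀ z : Qubits n, (fun l => z (f l)) = fun _ => z (e j) := fun z =>
      funext fun l => by rw [hall l, hij]
    simp only [actOn, Matrix.of_apply, qubitOp_apply, hx]
    rw [← ite_and]
    refine if_congr ⟨fun H => ⟨fun l hl => H l fun l' => ?_, fun l hl => H _ fun l' => ?_⟩,
      fun H l hl => ?_⟩ rfl rfl
    · rw [hall l', hij]; exact hl j
    · rw [hall l', hij]; exact fun h => hl (e.injective h).symm
    · by_cases hl' : ∃ j', e j' = l
      · obtain ⟨j', rfl⟩ := hl'
        exact H.2 j' fun h => hl i (by rw [hij, h])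
      · exact H.1 l (not_exists.mp hl')

theorem isIdentityOn_zero {n k : ℕ} (keep : Fin k ↪ Fin n) : IsIdentityOn keep (0 : Op n) :=
  ⟨fun _ _ => 0, by simp⟩

theorem isIdentityOn_actOn (h : 4 ≤ 6) (W : Op 4) :
    IsIdentityOn (Fin.natAddEmb 4 : Fin 2 ↪ Fin 6) (actOn (Fin.castLEEmb h) W) := by
  have hr : ∀ j : Fin 4, ∀ i : Fin 2, Fin.natAddEmb 4 i ≠ Fin.castLE h j := by decide +revert
  refine ⟨fun r s => W (fun j => r ⟨Fin.castLE h j, hr j⟩) (fun j => s ⟨Fin.castLE h j, hr j⟩), ?_⟩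
  intro x y
  simp only [actOn, Matrix.of_apply]
  refine if_congr ⟨fun H j => H _ fun i => ?_, fun H i hi => ?_⟩ rfl rfl
  · exact (hr i j).symm
  · fin_cases i
    · exact absurd rfl (hi 0)
    · exact absurd rfl (hi 1)
    · exact absurd rfl (hi 2)
    · exact absurd rfl (hi 3)
    · exact H 0
    · exact H 1

/-- After decoding, qubits `0` and `1` carry the identity, qubits `2` and `3` the projector onto
`|00⟩`, and qubits `4` and `5` whatever error `B` occurred there. -/
theorem isIdentityOn_ancillaProj (h : 4 ≤ 6) (h' : 2 ≤ 6)
    (B : Matrix (Rest (Fin.castLEEmb h) → Fin 2) (Rest (Fin.castLEEmb h) → Fin 2) ℂ) :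
    IsIdentityOn (Fin.castLEEmb h') (actOn (Fin.castLEEmb h) ancillaProj *
      restOn (Fin.castLEEmb h) B) := by
  have h2 : ∀ i : Fin 2, Fin.castLEEmb h' i ≠ 2 := by decide +revert
  have h3 : ∀ i : Fin 2, Fin.castLEEmb h' i ≠ 3 := by decide +revert
  have hr : ∀ i : Rest (Fin.castLEEmb h), ∀ j, Fin.castLEEmb h' j ≠ i := by
    rintro ⟨i, hi⟩ j hj
    refine hi (Fin.castLE (by norm_num) j) ?_
    exact (Fin.ext rfl : _ = Fin.castLEEmb h' j).trans hj
  refine ⟨fun r s => if (r ⟨2, h2⟩ = 0 ∧ r ⟨3, h3⟩ = 0) ∧ s ⟨2, h2⟩ = 0 ∧ s ⟨3, h3⟩ = 0 then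
    B (fun i => r ⟨i, hr i⟩) (fun i => s ⟨i, hr i⟩) else 0, fun x y => ?_⟩
  rw [actOn_mul_restOn, Matrix.submatrix_apply, splitQubits_apply, splitQubits_apply,
    Matrix.kroneckerMap_apply, ancillaProj, Matrix.diagonal_apply]
  simp only [funext_iff, Fin.forall_fin_succ, IsEmpty.forall_iff, Fin.castLEEmb_apply]
  have e0 : Fin.castLE h 0 = 0 := rfl
  have e1 : Fin.castLE h (Fin.succ 0) = 1 := rfl
  have e2 : Fin.castLE h (Fin.succ (Fin.succ 0)) = 2 := rfl
  have e3 : Fin.castLE h (Fin.succ (Fin.succ (Fin.succ 0))) = 3 := rfl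
  have e2' : Fin.castLE h 2 = 2 := rfl
  have e3' : Fin.castLE h 3 = 3 := rfl
  have f0 : Fin.castLE h' 0 = 0 := rfl
  have f1 : Fin.castLE h' (Fin.succ 0) = 1 := rfl
  simp only [e0, e1, e2, e3, e2', e3', f0, f1, and_true]
  by_cases hx2 : x 2 = 0 <;> by_cases hx3 : x 3 = 0 <;> by_cases hy2 : y 2 = 0 <;>
    by_cases hy3 : y 3 = 0 <;> simp [hx2, hx3, hy2, hy3, ite_and, eq_comm] <;> grind

theorem sixPairProtocol_isTwoEPP : (sixPairProtocol decoder).IsTwoEPP := by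
  have h46 : 4 ≤ 6 := by norm_num
  refine ⟨by simp, fun a₁ b₁ => ⟨?_, fun a₂ b₂ => ?_⟩⟩
  · intro L hL
    rw [List.mem_singleton] at hL
    rw [hL, pauliOp_onFirstFour _ h46, pauliOp_onFirstFour _ h46, Commute, SemiconjBy,
      ← actOn_mul, ← actOn_mul, commute_xxxx_zzzz.eq]
  · beta_reduce
    split_ifs
    · exact ⟨actOn_mem_unitaryGroup _ (decoder_mem_unitaryGroup _ _),
        actOn_mem_unitaryGroup _ (decoder_mem_unitaryGroup _ _)⟩
    · exact ⟨one_mem _, one_mem _⟩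

theorem codeProj_transpose (a₁ a₂ : Bool) : (codeProj a₁ a₂)ᵀ = codeProj a₁ a₂ := by
  nth_rewrite 1 [codeProj]
  rw [Matrix.transpose_mul, pauliProj_transpose _ _ pauliOp_xxxx_transpose,
    pauliProj_transpose _ _ pauliOp_zzzz_transpose, codeProj_eq]

theorem codeProj_mul_of_ne {a₁ a₂ b₁ b₂ : Bool} (h : ¬ (a₁ = b₁ ∧ a₂ = b₂)) :
    codeProj a₁ a₂ * codeProj b₁ b₂ = 0 := by
  by_cases h1 : a₁ = b₁
  · have h2 : a₂ ≠ b₂ := fun h2 => h ⟨h1, h2⟩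
    rw [codeProj_eq, codeProj, mul_assoc, ← mul_assoc (pauliProj zzzz a₂),
      pauliProj_mul_of_ne _ h2, zero_mul, mul_zero]
  · nth_rewrite 2 [codeProj_eq]
    rw [codeProj, mul_assoc, ← mul_assoc (pauliProj xxxx a₁),
      pauliProj_mul_of_ne _ h1, zero_mul, mul_zero]

/-- A protocol that turns each pure state `(1 ⊗ N) |EPR⟩` with a local error `N` into perfect
pairs corrects all channels. -/
theorem Protocol.corrects_of_pureState {n k : ℕ} {P : Protocol n k} {t : ℕ}
    (h : ∀ m ≤ t, ∀ (e : Fin m ↪ Fin n) (N : Op m),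
      P.AlwaysPerfect (pureState (actOn e N))) : P.Corrects t := by
  intro m hm e r N _
  refine .sum _ fun i => ?_
  -- Bob's Kraus operator arrives transposed, which is harmless because `h` covers all operators on
  -- the same qubits.
  rw [eprState_eq_smul_pureState, Matrix.mul_smul, Matrix.smul_mul, kronecker_conj_pureState,
    one_mul, one_mul, actOn_transpose]
  exact (h m hm e _).smul _

theorem sixPairProtocol_corrects : (sixPairProtocol decoder).Corrects 1 := by
  refine Protocol.corrects_of_pureState fun m hm f N => ?_
  have h46 : 4 ≤ 6 := by norm_num
  intro a₁ b₁ a₂ b₂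
  have hst : pauliProj (onFirstFour zzzz) a₂ * (pauliProj (onFirstFour xxxx) a₁ * actOn f N *
      (pauliProj (onFirstFour xxxx) b₁)ᵀ) * (pauliProj (onFirstFour zzzz) b₂)ᵀ =
      actOn (Fin.castLEEmb h46) (codeProj a₁ a₂) * actOn f N *
        actOn (Fin.castLEEmb h46) (codeProj b₁ b₂) := by
    rw [← codeProj_transpose b₁ b₂, codeProj, codeProj, Matrix.transpose_mul]
    simp only [pauliProj_onFirstFour _ _ h46, actOn_transpose, actOn_mul, mul_assoc]
  rw [kronecker_conj_pureState, kronecker_conj_pureState, hst]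
  beta_reduce
  split_ifs with hab
  · obtain ⟨rfl, rfl⟩ := hab
    have hU := actOn_mem_unitaryGroup (Fin.castLEEmb h46) (decoder_mem_unitaryGroup a₁ a₂)
    refine alwaysPerfect_finish_pureState _ hU hU _ ?_
    -- Given this form, conjugation by the decoder affects only the code projector, since `restOn`
    -- commutes with everything on the first four qubits.
    suffices H : ∃ B, actOn (Fin.castLEEmb h46) (codeProj a₁ a₂) * actOn f N *
        actOn (Fin.castLEEmb h46) (codeProj a₁ a₂) =
        actOn (Fin.castLEEmb h46) (codeProj a₁ a₂) * restOn (Fin.castLEEmb h46) B by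
      obtain ⟨B, hB⟩ := H
      rw [hB, mul_assoc, mul_assoc, actOn_transpose, ← (commute_actOn_restOn _ _ B).eq,
        ← mul_assoc, ← mul_assoc, ← actOn_mul, ← actOn_mul,
        decoder_mul_codeProj_mul_transpose]
      exact isIdentityOn_ancillaProj h46 _ B
    rcases actOn_cases (Fin.castLEEmb h46) hm f N with ⟨i, A, hA⟩ | ⟨B, hB⟩
    · refine ⟨((A 0 0 + A 1 1) / 2) • 1, ?_⟩
      rw [hA, ← actOn_mul, ← actOn_mul, codeProj_mul_qubitOp, actOn_smul, restOn_smul_one,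
        Matrix.mul_smul, mul_one]
    · refine ⟨B, ?_⟩
      rw [hB, mul_assoc, ← (commute_actOn_restOn _ _ B).eq, ← mul_assoc, ← actOn_mul,
        codeProj_mul_self]
  · refine alwaysPerfect_finish_pureState _ (one_mem _) (one_mem _) _ ?_
    rw [Matrix.transpose_one, one_mul, mul_one]
    -- Either the error is on the first four qubits and the last two pairs are untouched, or it
    -- commutes with the projectors, whose product vanishes: this branch has probability zero.
    rcases actOn_cases (Fin.castLEEmb h46) hm f N with ⟨i, A, hA⟩ | ⟨B, hB⟩
    · rw [hA, ← actOn_mul, ← actOn_mul]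
      exact isIdentityOn_actOn _ _
    · rw [hB, mul_assoc, ← (commute_actOn_restOn _ _ B).eq, ← mul_assoc, ← actOn_mul,
        codeProj_mul_of_ne hab, actOn_zero, zero_mul]
      exact isIdentityOn_zero _

/-! ### Purity inequalities for codes on three ququarts. -/

section purity

/-- The partial trace over the second factor. -/
def traceRight {β γ : Type*} [Fintype γ] (S : Matrix (β × γ) (β × γ) ℂ) : Matrix β β ℂ :=
  Matrix.of fun b b' => ∑ c, S (b, c) (b', c)

/-- The partial trace over the first factor. -/
def traceLeft {β γ : Type*} [Fintype β] (S : Matrix (β × γ) (β × γ) ℂ) : Matrix γ γ ℂ :=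
  Matrix.of fun c c' => ∑ b, S (b, c) (b, c')

theorem trace_mul_kronecker_one {β γ : Type*} [Fintype β] [Fintype γ] [DecidableEq γ]
    (S : Matrix (β × γ) (β × γ) ℂ) (X : Matrix β β ℂ) :
    (S * (X ⊗ₖ (1 : Matrix γ γ ℂ))).trace = (traceRight S * X).trace := by
  simp only [Matrix.trace, Matrix.diag_apply, Matrix.mul_apply, Fintype.sum_prod_type,
    Matrix.kroneckerMap_apply, Matrix.one_apply, mul_ite, mul_one, mul_zero,
    Finset.sum_ite_eq', Finset.mem_univ, if_true, traceRight, Matrix.of_apply, Finset.sum_mul]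
  exact Finset.sum_congr rfl fun b _ => Finset.sum_comm

theorem trace_mul_one_kronecker {β γ : Type*} [Fintype β] [Fintype γ] [DecidableEq β]
    (S : Matrix (β × γ) (β × γ) ℂ) (Y : Matrix γ γ ℂ) :
    (S * ((1 : Matrix β β ℂ) ⊗ₖ Y)).trace = (traceLeft S * Y).trace := by
  simp only [Matrix.trace, Matrix.diag_apply, Matrix.mul_apply, Fintype.sum_prod_type,
    Matrix.kroneckerMap_apply, Matrix.one_apply, ite_mul, one_mul, zero_mul, mul_ite, mul_zero,
    traceLeft, Matrix.of_apply, Finset.sum_mul]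
  have h : ∀ b c, ∑ b', ∑ c', (if b' = b then S (b, c) (b', c') * Y c' c else 0) =
      ∑ c', S (b, c) (b, c') * Y c' c := by
    intro b c
    rw [Finset.sum_eq_single b (fun b' _ hb => by simp [hb]) (by simp)]
    simp
  simp only [h]
  rw [Finset.sum_comm]
  exact Finset.sum_congr rfl fun c _ => Finset.sum_comm

theorem trace_traceRight {β γ : Type*} [Fintype β] [Fintype γ]
    (S : Matrix (β × γ) (β × γ) ℂ) : (traceRight S).trace = S.trace := by
  simp [traceRight, Matrix.trace, Fintype.sum_prod_type]

theorem trace_traceLeft {β γ : Type*} [Fintype β] [Fintype γ]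
    (S : Matrix (β × γ) (β × γ) ℂ) : (traceLeft S).trace = S.trace := by
  simp only [traceLeft, Matrix.trace, Fintype.sum_prod_type, Matrix.diag_apply, Matrix.of_apply]
  exact Finset.sum_comm

theorem traceRight_isHermitian {β γ : Type*} [Fintype γ]
    {S : Matrix (β × γ) (β × γ) ℂ} (hS : S.IsHermitian) :
    (traceRight S).IsHermitian := by
  ext b b'
  simp only [Matrix.conjTranspose_apply, traceRight, Matrix.of_apply, star_sum, hS.apply]

theorem traceLeft_isHermitian {β γ : Type*} [Fintype β]
    {S : Matrix (β × γ) (β × γ) ℂ} (hS : S.IsHermitian) :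
    (traceLeft S).IsHermitian := by
  ext b b'
  simp only [Matrix.conjTranspose_apply, traceLeft, Matrix.of_apply, star_sum, hS.apply]

theorem trace_mul_self_re_nonneg {α : Type*} [Fintype α] {S : Matrix α α ℂ} (hS : S.IsHermitian) :
    0 ≤ (S * S).trace.re := by
  have h := (Matrix.posSemidef_self_mul_conjTranspose S).trace_nonneg
  rw [hS.eq] at h
  exact (Complex.le_def.mp h).1

/-- The purity of a state on two ququarts is bounded below by the purities of its two parts. -/
theorem purity_marginals_le {β γ : Type*} [Fintype β] [Fintype γ] [DecidableEq β]
    [DecidableEq γ] {S : Matrix (β × γ) (β × γ) ℂ} (hS : S.IsHermitian)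
    (hβ : Fintype.card β = 4) (hγ : Fintype.card γ = 4) (htr : S.trace = 4) :
    (traceRight S * traceRight S).trace.re / 4 + (traceLeft S * traceLeft S).trace.re / 4 - 1 ≤
      (S * S).trace.re := by
  have hX : (traceRight S ⊗ₖ (1 : Matrix γ γ ℂ)).IsHermitian := by
    rw [Matrix.IsHermitian, Matrix.conjTranspose_kronecker, (traceRight_isHermitian hS).eq,
      Matrix.conjTranspose_one]
  have hY : ((1 : Matrix β β ℂ) ⊗ₖ traceLeft S).IsHermitian := by
    rw [Matrix.IsHermitian, Matrix.conjTranspose_kronecker, (traceLeft_isHermitian hS).eq,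
      Matrix.conjTranspose_one]
  have hSX := trace_mul_kronecker_one S (traceRight S)
  have hSY := trace_mul_one_kronecker S (traceLeft S)
  set X := traceRight S ⊗ₖ (1 : Matrix γ γ ℂ) with hXdef
  set Y := (1 : Matrix β β ℂ) ⊗ₖ traceLeft S with hYdef
  have hXX : (X * X).trace = 4 * (traceRight S * traceRight S).trace := by
    rw [hXdef, ← Matrix.mul_kronecker_mul, Matrix.trace_kronecker, one_mul, Matrix.trace_one, hγ]
    push_cast; ring
  have hYY : (Y * Y).trace = 4 * (traceLeft S * traceLeft S).trace := by
    rw [hYdef, ← Matrix.mul_kronecker_mul, Matrix.trace_kronecker, one_mul, Matrix.trace_one, hβ]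
    push_cast; ring
  have hXY : (X * Y).trace = 16 := by
    rw [hXdef, hYdef, ← Matrix.mul_kronecker_mul, Matrix.trace_kronecker, one_mul, mul_one,
      trace_traceRight, trace_traceLeft, htr]
    norm_num
  have hXt : X.trace = 16 := by
    rw [hXdef, Matrix.trace_kronecker, trace_traceRight, htr, Matrix.trace_one, hγ]
    norm_num
  have hYt : Y.trace = 16 := by
    rw [hYdef, Matrix.trace_kronecker, trace_traceLeft, htr, Matrix.trace_one, hβ]
    norm_num
  have hone : (1 : Matrix (β × γ) (β × γ) ℂ).trace = 16 := by
    rw [Matrix.trace_one, Fintype.card_prod, hβ, hγ]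
    norm_num
  -- This is the part of `S` whose two partial traces vanish; the last coefficient is `tr S / 16`.
  -- Its squared Hilbert-Schmidt norm is nonnegative, which is the claim.
  have hT : (S - (1 / 4 : ℝ) • X - (1 / 4 : ℝ) • Y + (1 / 4 : ℝ) • 1).IsHermitian :=
    ((hS.sub (hX.smul (.all _))).sub (hY.smul (.all _))).add (Matrix.isHermitian_one.smul (.all _))
  have hmain := trace_mul_self_re_nonneg hT
  have hexp : ((S - (1 / 4 : ℝ) • X - (1 / 4 : ℝ) • Y + (1 / 4 : ℝ) • 1) *
      (S - (1 / 4 : ℝ) • X - (1 / 4 : ℝ) • Y + (1 / 4 : ℝ) • 1)).trace =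
      (S * S).trace - (traceRight S * traceRight S).trace / 4 -
        (traceLeft S * traceLeft S).trace / 4 + 1 := by
    simp only [mul_add, mul_sub, add_mul, sub_mul, Matrix.trace_add, Matrix.trace_sub, mul_one,
      one_mul, smul_mul_assoc, mul_smul_comm, Matrix.trace_smul, Matrix.trace_mul_comm X S,
      Matrix.trace_mul_comm Y S, Matrix.trace_mul_comm Y X, hSX, hSY, hXX, hYY, hXY, hXt, hYt,
      htr, hone, Complex.real_smul]
    push_cast
    ring
  rw [hexp] at hmain
  simp only [Complex.add_re, Complex.sub_re, Complex.one_re, Complex.div_ofNat_re] at hmain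
  linarith

theorem trace_smul_transpose_mul_self_re {δ : Type*} [Fintype δ] (ρ : Matrix δ δ ℂ) :
    ((4 : ℂ) • ρᵀ * (4 : ℂ) • ρᵀ).trace.re = 16 * (ρ * ρ).trace.re := by
  rw [smul_mul_smul_comm, ← Matrix.transpose_mul, Matrix.trace_smul, Matrix.trace_transpose,
    smul_eq_mul]
  norm_num

variable {κ α β γ : Type*} [Fintype κ] [Fintype α] [Fintype β] [Fintype γ]
  [DecidableEq κ] [DecidableEq β] [DecidableEq γ] (v : κ → α → β → γ → ℂ)
  (ρ₁ : Matrix α α ℂ) (ρ₂ : Matrix β β ℂ) (ρ₃ : Matrix γ γ ℂ)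

/-- If a four-dimensional code on three ququarts leaks no information into any of them, then the
purity of one of them bounds the purities of the other two. -/
theorem purity_le_of_no_leak (hκ : Fintype.card κ = 4) (hβ : Fintype.card β = 4)
    (hγ : Fintype.card γ = 4)
    (h₁ : ∀ k k' a a', ∑ b, ∑ c, v k a b c * star (v k' a' b c) =
      if k = k' then ρ₁ a a' else 0)
    (h₂ : ∀ k k' b b', ∑ a, ∑ c, v k a b c * star (v k' a b' c) =
      if k = k' then ρ₂ b b' else 0)
    (h₃ : ∀ k k' c c', ∑ a, ∑ b, v k a b c * star (v k' a b c') =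
      if k = k' then ρ₃ c c' else 0)
    (htr : ρ₁.trace = 1) :
    (ρ₂ * ρ₂).trace.re + (ρ₃ * ρ₃).trace.re - 1 / 4 ≤ (ρ₁ * ρ₁).trace.re := by
  -- With `κ` as a reference system, `G` holds the amplitudes across the cut between `κ × α` and `β
  -- × γ`. `G * Gᴴ` and `Gᴴ * G` have the same purity; the first is a product by `h₁`, the second
  -- has marginals given by `ρ₂` and `ρ₃`.
  let G : Matrix (κ × α) (β × γ) ℂ := Matrix.of fun p q => v p.1 p.2 q.1 q.2
  have hG : G * Gᴴ = (1 : Matrix κ κ ℂ) ⊗ₖ ρ₁ := by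
    ext p q
    simp only [Matrix.mul_apply, Fintype.sum_prod_type, Matrix.conjTranspose_apply, G,
      Matrix.of_apply, h₁, Matrix.kroneckerMap_apply, Matrix.one_apply, ite_mul, one_mul,
      zero_mul]
  have hStr : (Gᴴ * G).trace = 4 := by
    rw [Matrix.trace_mul_comm, hG, Matrix.trace_kronecker, htr, Matrix.trace_one, hκ]
    norm_num
  have hSS : (Gᴴ * G * (Gᴴ * G)).trace = 4 * (ρ₁ * ρ₁).trace := by
    rw [Matrix.mul_assoc, Matrix.trace_mul_comm, ← Matrix.mul_assoc G, Matrix.mul_assoc (G * Gᴴ), hG,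
      ← Matrix.mul_kronecker_mul, Matrix.trace_kronecker, one_mul, Matrix.trace_one, hκ]
    norm_num
  have hB : traceRight (Gᴴ * G) = (4 : ℂ) • ρ₂ᵀ := by
    ext b b'
    have h : ∀ k, ∑ a, ∑ c, v k a b' c * star (v k a b c) = ρ₂ b' b := by
      intro k; rw [h₂, if_pos rfl]
    calc traceRight (Gᴴ * G) b b' = ∑ c, ∑ k, ∑ a, v k a b' c * star (v k a b c) := by
          simp only [traceRight, Matrix.of_apply, Matrix.mul_apply, Matrix.conjTranspose_apply, G,
            Fintype.sum_prod_type, mul_comm]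
      _ = ∑ k, ∑ a, ∑ c, v k a b' c * star (v k a b c) := by
          rw [Finset.sum_comm]
          exact Finset.sum_congr rfl fun k _ => Finset.sum_comm
      _ = _ := by simp only [h]; simp [hκ]
  have hC : traceLeft (Gᴴ * G) = (4 : ℂ) • ρ₃ᵀ := by
    ext c c'
    have h : ∀ k, ∑ a, ∑ b, v k a b c' * star (v k a b c) = ρ₃ c' c := by
      intro k; rw [h₃, if_pos rfl]
    calc traceLeft (Gᴴ * G) c c' = ∑ b, ∑ k, ∑ a, v k a b c' * star (v k a b c) := by
          simp only [traceLeft, Matrix.of_apply, Matrix.mul_apply, Matrix.conjTranspose_apply, G,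
            Fintype.sum_prod_type, mul_comm]
      _ = ∑ k, ∑ a, ∑ b, v k a b c' * star (v k a b c) := by
          rw [Finset.sum_comm]
          exact Finset.sum_congr rfl fun k _ => Finset.sum_comm
      _ = _ := by simp only [h]; simp [hκ]
  have h := purity_marginals_le (Matrix.isHermitian_conjTranspose_mul_self G) hβ hγ hStr
  have h4 : ∀ z : ℂ, (4 * z).re = 4 * z.re := fun z => by simp
  rw [hSS, hB, hC, trace_smul_transpose_mul_self_re, trace_smul_transpose_mul_self_re, h4] at h
  linarith

/-- If a four-dimensional code on three ququarts leaks no information into any of them, then each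
of them is maximally mixed. -/
theorem eq_of_no_leak [DecidableEq α] (hκ : Fintype.card κ = 4) (hα : Fintype.card α = 4)
    (hβ : Fintype.card β = 4) (hγ : Fintype.card γ = 4)
    (h₁ : ∀ k k' a a', ∑ b, ∑ c, v k a b c * star (v k' a' b c) =
      if k = k' then ρ₁ a a' else 0)
    (h₂ : ∀ k k' b b', ∑ a, ∑ c, v k a b c * star (v k' a b' c) =
      if k = k' then ρ₂ b b' else 0)
    (h₃ : ∀ k k' c c', ∑ a, ∑ b, v k a b c * star (v k' a b c') =
      if k = k' then ρ₃ c c' else 0)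
    (hnorm : ∀ k, ∑ a, ∑ b, ∑ c, v k a b c * star (v k a b c) = 1) :
    ρ₃ = (1 / 4 : ℝ) • 1 := by
  have hne : Nonempty κ := Fintype.card_pos_iff.mp (by omega)
  obtain ⟨k⟩ := hne
  have ht1 : ρ₁.trace = 1 := by
    rw [← hnorm k, Matrix.trace]
    exact Finset.sum_congr rfl fun a _ => by rw [h₁, if_pos rfl, Matrix.diag_apply]
  have ht2 : ρ₂.trace = 1 := by
    rw [← hnorm k, Matrix.trace, Finset.sum_comm]
    exact Finset.sum_congr rfl fun a _ => by rw [h₂, if_pos rfl, Matrix.diag_apply]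
  have ht3 : ρ₃.trace = 1 := by
    rw [← hnorm k, Matrix.trace]
    simp only [Matrix.diag_apply]
    have : ∀ c, ρ₃ c c = ∑ a, ∑ b, v k a b c * star (v k a b c) := fun c => by
      rw [h₃, if_pos rfl]
    simp only [this]
    rw [Finset.sum_comm]
    exact Finset.sum_congr rfl fun a _ => Finset.sum_comm
  have hherm : ρ₃.IsHermitian := by
    ext c c'
    have e : ∀ c c', ρ₃ c c' = ∑ a, ∑ b, v k a b c * star (v k a b c') := fun c c' => by
      rw [h₃, if_pos rfl]
    rw [Matrix.conjTranspose_apply, e, e]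
    simp only [star_sum, star_mul', star_star, mul_comm]
  have i1 := purity_le_of_no_leak v ρ₁ ρ₂ ρ₃ hκ hβ hγ h₁ h₂ h₃ ht1
  -- The sum of `i1` and `i2` bounds the purity of `ρ₃` by `1/4`. As `ρ₃` has trace one, its squared
  -- distance from `1/4` is its purity minus `1/4`, hence zero.
  have i2 := purity_le_of_no_leak (fun k b a c => v k a b c) ρ₂ ρ₁ ρ₃ hκ hα hγ h₂ h₁
    (fun k k' c c' => by rw [Finset.sum_comm, h₃]) ht2
  have hT : (ρ₃ - (1 / 4 : ℝ) • 1).IsHermitian :=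
    hherm.sub (Matrix.isHermitian_one.smul (.all _))
  have hnn := (Matrix.posSemidef_self_mul_conjTranspose (ρ₃ - (1 / 4 : ℝ) • 1)).trace_nonneg
  have hexp : ((ρ₃ - (1 / 4 : ℝ) • 1) * (ρ₃ - (1 / 4 : ℝ) • 1)ᴴ).trace =
      (ρ₃ * ρ₃).trace - 1 / 4 := by
    rw [hT.eq]
    simp only [mul_sub, sub_mul, Matrix.trace_sub, mul_one, one_mul, smul_mul_assoc,
      mul_smul_comm, Matrix.trace_smul, ht3, Matrix.trace_one, hγ, Complex.real_smul]
    push_cast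
    ring
  have hre := (Complex.le_def.mp hnn).1
  have him := (Complex.le_def.mp hnn).2
  have hz : ((ρ₃ - (1 / 4 : ℝ) • 1) * (ρ₃ - (1 / 4 : ℝ) • 1)ᴴ).trace = 0 := by
    refine Complex.ext ?_ him.symm
    rw [hexp] at hre ⊢
    simp only [Complex.zero_re, Complex.sub_re, Complex.div_ofNat_re, Complex.one_re] at hre ⊢
    linarith
  exact sub_eq_zero.mp (Matrix.trace_mul_conjTranspose_self_eq_zero_iff.mp hz)

end purity

/-! ### From exact recovery to the Knill-Laflamme conditions -/

/-- Applying the channel to `|ψ⟩⟨ψ|` and taking the expectation in `φ` gives `∑ |⟨φ, K i ψ⟩|² = |⟨φ,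
ψ⟩|² = 0`, a sum of nonnegative terms. -/
theorem dotProduct_kraus_eq_zero {ι σ : Type*} [Fintype ι] [Fintype σ]
    (K : σ → Matrix ι ι ℂ)
    (h : ∀ ρ : Matrix ι ι ℂ, ρ.PosSemidef → ρ.trace = 1 → ∑ i, K i * ρ * (K i)ᴴ = ρ)
    (ψ φ : ι → ℂ) (hφ : star φ ⬝ᵥ ψ = 0) (i : σ) : star φ ⬝ᵥ (K i *ᵥ ψ) = 0 := by
  by_cases hψ : ψ = 0
  · simp [hψ]
  have hpos : 0 < ψ ⬝ᵥ star ψ :=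
    Matrix.dotProduct_self_star_pos_iff.mpr hψ
  set c := ψ ⬝ᵥ star ψ with hc
  have hinv : 0 ≤ c⁻¹ := inv_nonneg.mpr hpos.le
  have h1 := h (c⁻¹ • Matrix.vecMulVec ψ (star ψ))
    ((Matrix.posSemidef_vecMulVec_self_star ψ).smul hinv)
    (by rw [Matrix.trace_smul, Matrix.trace_vecMulVec, smul_eq_mul, ← hc,
      inv_mul_cancel₀ hpos.ne'])
  have h2 : ∑ i, K i * Matrix.vecMulVec ψ (star ψ) * (K i)ᴴ = Matrix.vecMulVec ψ (star ψ) := by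
    have h3 := congrArg (fun M => c • M) h1
    simpa only [Matrix.mul_smul, Matrix.smul_mul, ← Finset.smul_sum,
      smul_inv_smul₀ hpos.ne'] using h3
  have h4 := congrArg (fun M => star φ ⬝ᵥ (M *ᵥ φ)) h2
  simp only [Matrix.mul_vecMulVec, Matrix.vecMulVec_mul, ← Matrix.star_mulVec,
    Matrix.sum_mulVec, Matrix.vecMulVec_mulVec, dotProduct_sum, dotProduct_smul, hφ] at h4
  have h5 : ∀ i, 0 ≤ MulOpposite.op (star (K i *ᵥ ψ) ⬝ᵥ φ) • (star φ ⬝ᵥ K i *ᵥ ψ) := by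
    intro i
    rw [Matrix.star_dotProduct, op_smul_eq_mul]
    exact mul_star_self_nonneg _
  rw [smul_zero, Finset.sum_eq_zero_iff_of_nonneg fun i _ => h5 i] at h4
  have h6 := h4 i (Finset.mem_univ i)
  rw [Matrix.star_dotProduct, op_smul_eq_mul] at h6
  exact CStarRing.mul_star_self_eq_zero_iff _ |>.mp h6

/-- The Kraus operators of the identity channel are scalars. -/
theorem kraus_eq_smul_one {ι σ : Type*} [Fintype ι] [DecidableEq ι] [Nonempty ι] [Fintype σ]
    (K : σ → Matrix ι ι ℂ)
    (h : ∀ ρ : Matrix ι ι ℂ, ρ.PosSemidef → ρ.trace = 1 → ∑ i, K i * ρ * (K i)ᴴ = ρ)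
    (i : σ) : ∃ c : ℂ, K i = c • 1 := by
  have key := fun ψ φ hφ => dotProduct_kraus_eq_zero K h ψ φ hφ i
  have hoff : ∀ x y, x ≠ y → K i x y = 0 := by
    intro x y hxy
    have := key (Pi.single y 1) (Pi.single x 1) (by simp [Pi.star_single, hxy])
    simpa [Pi.star_single] using this
  have hdiag : ∀ x y, K i x x = K i y y := by
    intro x y
    by_cases hxy : x = y
    · rw [hxy]
    -- The orthogonal vectors `e_x + e_y` and `e_x - e_y` compare the two diagonal entries once the
    -- off-diagonal ones vanish.
    have := key (Pi.single x 1 + Pi.single y 1) (Pi.single x 1 - Pi.single y 1) (by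
      simp [Pi.star_single, hxy, Ne.symm hxy])
    simp only [star_sub, Pi.star_single, star_one, sub_dotProduct, Matrix.mulVec_add,
      Matrix.mulVec_single_one, single_dotProduct, one_mul, Pi.add_apply, Matrix.col_apply,
      hoff x y hxy, hoff y x (Ne.symm hxy)] at this
    linear_combination this
  obtain ⟨x₀⟩ := ‹Nonempty ι›
  refine ⟨K i x₀ x₀, ?_⟩
  ext x y
  by_cases hxy : x = y
  · subst hxy; simp [hdiag x x₀]
  · simp [hxy, hoff x y hxy]

theorem actOn_qubitOp {m n : ℕ} (e : Fin m ↪ Fin n) (i : Fin m)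
    (A : Matrix (Fin 2) (Fin 2) ℂ) : actOn e (qubitOp i A) = qubitOp (e i) A := by
  ext x y
  simp only [actOn, Matrix.of_apply, qubitOp_apply]
  rw [← ite_and]
  refine if_congr ⟨fun H l hl => ?_, fun H => ⟨fun l hl => H l (hl i).symm, fun j hj =>
    H _ (e.injective.ne hj)⟩⟩ rfl rfl
  by_cases hl' : ∃ j, e j = l
  · obtain ⟨j, rfl⟩ := hl'
    exact H.2 j fun h => hl (by rw [h])
  · exact H.1 l (not_exists.mp hl')

/-- An isometric encoding that satisfies the Knill-Laflamme conditions for the correction of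
single-qubit errors. -/
def SatisfiesKnillLaflamme {n k : ℕ} (V : Matrix (Qubits n) (Qubits k) ℂ) : Prop :=
  Vᴴ * V = 1 ∧ ∀ i j A B, ∃ c : ℂ, Vᴴ * (qubitOp i A * qubitOp j B : Op n) * V = c • (1 : Op k)

/-- Each `D j * P * E l` with a Pauli error `P` is a Kraus operator of the identity channel, hence a
scalar. Any nonzero `E l` is then proportional to an isometry with the required property, so general
encoding channels give nothing beyond isometries. -/
theorem exists_knillLaflamme_of_existsQECC {n k : ℕ} (i₀ : Fin n) (h : ExistsQECC n k 1) :
    ∃ V : Matrix (Qubits n) (Qubits k) ℂ, SatisfiesKnillLaflamme V := by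
  obtain ⟨rE, rD, E, D, hE, hD, hrec⟩ := h
  have hpauli : ∀ (i : Fin n) (p : Pauli) (j : Fin rD) (l : Fin rE),
      ∃ c : ℂ, D j * qubitOp i p.toMatrix * E l = c • 1 := by
    intro i p j l
    let e : Fin 1 ↪ Fin n := ⟨fun _ => i, fun _ _ _ => Subsingleton.elim _ _⟩
    have hN : IsChannel (fun _ : Fin 1 => (qubitOp 0 p.toMatrix : Op 1)) := by
      simp [IsChannel, qubitOp_conjTranspose, pauli_conjTranspose, qubitOp_mul,
        pauli_mul_self, qubitOp_one]
    have h1 := hrec 1 le_rfl e 1 _ hN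
    simp only [actOn_qubitOp, show e 0 = i from rfl] at h1
    refine kraus_eq_smul_one (fun q : Fin rD × Fin rE => D q.1 * qubitOp i p.toMatrix * E q.2)
      (fun ρ hρ ht => ?_) (j, l)
    conv_rhs => rw [← h1 ρ hρ ht]
    simp only [applyKraus, Fintype.sum_prod_type, Finset.univ_unique, Finset.sum_singleton,
      Matrix.mul_sum, Matrix.sum_mul, Matrix.conjTranspose_mul, Matrix.mul_assoc]
  have hall : ∀ (i : Fin n) (A : Matrix (Fin 2) (Fin 2) ℂ) (j : Fin rD) (l : Fin rE),
      ∃ c : ℂ, D j * qubitOp i A * E l = c • 1 := by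
    intro i A j l
    obtain ⟨cI, hI⟩ := hpauli i .I j l
    obtain ⟨cX, hX⟩ := hpauli i .X j l
    obtain ⟨cY, hY⟩ := hpauli i .Y j l
    obtain ⟨cZ, hZ⟩ := hpauli i .Z j l
    rw [show Pauli.I.toMatrix = 1 from rfl] at hI
    rw [matrix_eq_pauli_sum A]
    simp only [qubitOp_add, qubitOp_smul, Matrix.mul_add, Matrix.add_mul, Matrix.mul_smul,
      Matrix.smul_mul, hI, hX, hY, hZ, smul_smul, ← add_smul]
    exact ⟨_, rfl⟩
  -- The completeness relation `∑ (D d)ᴴ * D d = 1` is inserted between the two errors.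
  have hKL : ∀ i j A B l, ∃ c : ℂ,
      (E l)ᴴ * (qubitOp i A * qubitOp j B : Op n) * E l = c • (1 : Op k) := by
    intro i j A B l
    choose a ha using fun d => hall i Aᴴ d l
    choose b hb using fun d => hall j B d l
    refine ⟨∑ d, star (a d) * b d, ?_⟩
    calc (E l)ᴴ * (qubitOp i A * qubitOp j B : Op n) * E l
        = (E l)ᴴ * (qubitOp i A * (∑ d, (D d)ᴴ * D d) * qubitOp j B) * E l := by
          rw [show ∑ d, (D d)ᴴ * D d = 1 from hD, Matrix.mul_one]
      _ = ∑ d, (D d * qubitOp i Aᴴ * E l)ᴴ * (D d * qubitOp j B * E l) := by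
          simp only [Matrix.mul_sum, Matrix.sum_mul, Matrix.conjTranspose_mul,
            qubitOp_conjTranspose, Matrix.conjTranspose_conjTranspose, Matrix.mul_assoc]
      _ = _ := by
          simp only [ha, hb, Matrix.conjTranspose_smul, Matrix.conjTranspose_one,
            smul_mul_smul_comm, mul_one, Finset.sum_smul]
  obtain ⟨l, hl⟩ : ∃ l, E l ≠ 0 := by
    by_contra! hcon
    have : (1 : Op k) = 0 := by
      rw [← show ∑ i, (E i)ᴴ * E i = 1 from hE]
      simp [hcon]
    exact one_ne_zero this
  obtain ⟨c, hc⟩ := hKL i₀ i₀ 1 1 l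
  rw [qubitOp_one, Matrix.mul_one, Matrix.mul_one] at hc
  have hc0 : 0 ≤ c := by
    have := (Matrix.posSemidef_conjTranspose_mul_self (E l)).diag_nonneg (i := 0)
    rw [hc] at this
    simpa using this
  have hcne : c ≠ 0 := by
    rintro rfl
    rw [zero_smul, Matrix.conjTranspose_mul_self_eq_zero] at hc
    exact hl hc
  obtain ⟨t, ht0, rfl⟩ : ∃ t : ℝ, 0 ≤ t ∧ (t : ℂ) = c :=
    ⟨c.re, (Complex.le_def.mp hc0).1, Complex.ext rfl (Complex.le_def.mp hc0).2⟩
  have ht : (t : ℂ)⁻¹ = ((√t : ℝ) : ℂ)⁻¹ * ((√t : ℝ) : ℂ)⁻¹ := by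
    rw [← mul_inv, ← Complex.ofReal_mul, Real.mul_self_sqrt ht0]
  have hconj : star (((√t : ℝ) : ℂ)⁻¹) = ((√t : ℝ) : ℂ)⁻¹ := by
    rw [star_inv₀]; congr 1; exact Complex.conj_ofReal _
  refine ⟨((√t : ℝ) : ℂ)⁻¹ • E l, ?_, fun i j A B => ?_⟩
  · rw [Matrix.conjTranspose_smul, hconj, Matrix.smul_mul, Matrix.mul_smul, smul_smul, ← ht, hc,
      smul_smul, inv_mul_cancel₀ hcne, one_smul]
  · obtain ⟨c', hc'⟩ := hKL i j A B l
    rw [Matrix.conjTranspose_smul, Matrix.smul_mul, Matrix.smul_mul, Matrix.mul_smul, hc',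
      smul_smul, smul_smul]
    exact ⟨_, rfl⟩

/-! ### Six qubits as three pairs of qubits -/

/-- The basis label of six qubits with prescribed pairs. -/
def joinPairs (a b c : Fin 2 × Fin 2) : Qubits 6 := ![a.1, a.2, b.1, b.2, c.1, c.2]

theorem sum_qubits_six {M : Type*} [AddCommMonoid M] (F : Qubits 6 → M) :
    ∑ x, F x = ∑ a, ∑ b, ∑ c, F (joinPairs a b c) := by
  let T : (Fin 2 × Fin 2) × (Fin 2 × Fin 2) × (Fin 2 × Fin 2) ≃ Qubits 6 :=
    { toFun := fun p => joinPairs p.1 p.2.1 p.2.2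
      invFun := fun x => ((x 0, x 1), (x 2, x 3), (x 4, x 5))
      left_inv := fun p => rfl
      right_inv := fun x => by funext i; fin_cases i <;> rfl }
  rw [← T.sum_comp]
  simp only [Fintype.sum_prod_type (f := fun p : (Fin 2 × Fin 2) × _ => F (T p)),
    Fintype.sum_prod_type (f := fun p : (Fin 2 × Fin 2) × (Fin 2 × Fin 2) => F (T (_, p)))]
  rfl

theorem qubitOp_mul_qubitOp_apply {n : ℕ} {i j : Fin n} (hij : i ≠ j)
    (A B : Matrix (Fin 2) (Fin 2) ℂ) (x y : Qubits n) :
    (qubitOp i A * qubitOp j B) x y =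
      if ∀ l, l ≠ i → l ≠ j → x l = y l then A (x i) (y i) * B (x j) (y j) else 0 := by
  rw [qubitOp, qubitOp, tensorOp_mul]
  simp only [tensorOp, Matrix.of_apply, Pi.mul_apply]
  rw [← Finset.mul_prod_erase _ _ (Finset.mem_univ i), ← Finset.mul_prod_erase _ _
    (Finset.mem_erase.mpr ⟨hij.symm, Finset.mem_univ j⟩), ← mul_assoc]
  have h : ∀ l ∈ (Finset.univ.erase i).erase j,
      (Function.update (1 : Fin n → Matrix (Fin 2) (Fin 2) ℂ) i A l *
        Function.update (1 : Fin n → Matrix (Fin 2) (Fin 2) ℂ) j B l) (x l) (y l) =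
        if x l = y l then 1 else 0 := by
    intro l hl
    simp only [Finset.mem_erase, Finset.mem_univ, and_true] at hl
    rw [Function.update_of_ne hl.2, Function.update_of_ne hl.1]
    simp [Matrix.one_apply]
  rw [Finset.prod_congr rfl h, Finset.prod_ite_zero]
  simp only [Function.update_self, Function.update_of_ne hij, Function.update_of_ne hij.symm,
    Pi.one_apply, mul_one, one_mul, Finset.prod_const_one, mul_ite, mul_zero]
  refine if_congr ⟨fun H l h1 h2 => H l (by simp [h1, h2]), fun H l hl => ?_⟩ rfl rfl
  simp only [Finset.mem_erase, Finset.mem_univ, and_true] at hl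
  exact H l hl.2 hl.1

theorem qubitOp_submatrix_comp {n : ℕ} (π : Equiv.Perm (Fin n)) (i : Fin n)
    (A : Matrix (Fin 2) (Fin 2) ℂ) :
    (qubitOp i A).submatrix (fun x => x ∘ π.symm) (fun x => x ∘ π.symm) =
      qubitOp (π.symm i) A := by
  ext x y
  simp only [Matrix.submatrix_apply, qubitOp_apply, Function.comp_apply]
  refine if_congr ⟨fun H j hj => ?_, fun H j hj => H _ (π.symm.injective.ne hj)⟩ rfl rfl
  have := H (π j) fun h => hj (by rw [← h, Equiv.symm_apply_apply])
  rwa [Equiv.symm_apply_apply] at this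

theorem conj_submatrix_comp {n k : ℕ} (π : Equiv.Perm (Fin n))
    (V : Matrix (Qubits n) (Qubits k) ℂ) (M : Op n) :
    (V.submatrix (fun x => x ∘ π) id)ᴴ * M * V.submatrix (fun x => x ∘ π) id =
      Vᴴ * M.submatrix (fun x => x ∘ π.symm) (fun x => x ∘ π.symm) * V := by
  let φ : Qubits n ≃ Qubits n := Equiv.arrowCongr π.symm (Equiv.refl _)
  have hM : M = (M.submatrix φ.symm φ.symm).submatrix φ φ := by
    rw [Matrix.submatrix_submatrix]
    simp
  have h : (V.submatrix φ id)ᴴ * M * V.submatrix φ id = Vᴴ * M.submatrix φ.symm φ.symm * V := by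
    conv_lhs => rw [hM]
    rw [Matrix.conjTranspose_submatrix, Matrix.submatrix_mul_equiv, Matrix.submatrix_mul_equiv,
      Matrix.submatrix_id_id]
  exact h

theorem conj_mul_submatrix_comp {n k : ℕ} (π : Equiv.Perm (Fin n))
    (V : Matrix (Qubits n) (Qubits k) ℂ) (i j : Fin n) (A B : Matrix (Fin 2) (Fin 2) ℂ) :
    (V.submatrix (fun x => x ∘ π) id)ᴴ * (qubitOp i A * qubitOp j B : Op n) *
        V.submatrix (fun x => x ∘ π) id =
      Vᴴ * (qubitOp (π.symm i) A * qubitOp (π.symm j) B : Op n) * V := by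
  rw [conj_submatrix_comp, ← qubitOp_submatrix_comp, ← qubitOp_submatrix_comp]
  congr 2
  exact (Matrix.submatrix_mul_equiv (qubitOp i A) (qubitOp j B) _
    (Equiv.arrowCongr π (Equiv.refl _)) _).symm

/-- The conditions are symmetric in the qubits, so a fact about qubits `4` and `5` transfers to
every pair. -/
theorem SatisfiesKnillLaflamme.permute {n k : ℕ} {V : Matrix (Qubits n) (Qubits k) ℂ}
    (hV : SatisfiesKnillLaflamme V) (π : Equiv.Perm (Fin n)) :
    SatisfiesKnillLaflamme (V.submatrix (fun x => x ∘ π) id) := by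
  refine ⟨?_, fun i j A B => ?_⟩
  · have h := conj_submatrix_comp π V 1
    rw [Matrix.mul_one] at h
    rw [h, show (1 : Op n).submatrix (fun x => x ∘ π.symm) (fun x => x ∘ π.symm) = 1 from
      Matrix.submatrix_one_equiv (Equiv.arrowCongr π (Equiv.refl _)), Matrix.mul_one, hV.1]
  · rw [conj_mul_submatrix_comp]
    exact hV.2 _ _ A B

theorem joinPairs_agree_iff (a b c a' b' c' : Fin 2 × Fin 2) :
    (∀ l : Fin 6, l ≠ 4 → l ≠ 5 → joinPairs a b c l = joinPairs a' b' c' l) ↔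
      a' = a ∧ b' = b := by
  rw [Prod.ext_iff, Prod.ext_iff]
  constructor
  · intro H
    have h0 := H 0 (by decide) (by decide)
    have h1 := H 1 (by decide) (by decide)
    have h2 := H 2 (by decide) (by decide)
    have h3 := H 3 (by decide) (by decide)
    simp only [joinPairs, Matrix.cons_val] at h0 h1 h2 h3
    exact ⟨⟨h0.symm, h1.symm⟩, h2.symm, h3.symm⟩
  · rintro ⟨⟨h0, h1⟩, h2, h3⟩ l h4 h5
    fin_cases l <;> simp [joinPairs, h0, h1, h2, h3] at h4 h5 ⊢

theorem qubitOp_mul_qubitOp_joinPairs (A B : Matrix (Fin 2) (Fin 2) ℂ)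
    (a b c a' b' c' : Fin 2 × Fin 2) :
    (qubitOp 4 A * qubitOp 5 B : Op 6) (joinPairs a b c) (joinPairs a' b' c') =
      if a' = a ∧ b' = b then A c.1 c'.1 * B c.2 c'.2 else 0 := by
  have hiff := joinPairs_agree_iff a b c a' b' c'
  have h45 : (4 : Fin 6) ≠ 5 := by decide
  have e4 : ∀ a b c, joinPairs a b c 4 = c.1 := fun _ _ _ => rfl
  have e5 : ∀ a b c, joinPairs a b c 5 = c.2 := fun _ _ _ => rfl
  rw [qubitOp_mul_qubitOp_apply h45, if_congr hiff rfl rfl, e4, e4, e5, e5]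

theorem conj_apply_eq_sum {ι κ : Type*} [Fintype ι] (V : Matrix ι κ ℂ) (M : Matrix ι ι ℂ)
    (k k' : κ) : (Vᴴ * M * V) k k' = ∑ x, ∑ y, M x y * (V y k' * star (V x k)) := by
  simp only [Matrix.mul_apply, Matrix.conjTranspose_apply, Finset.sum_mul]
  rw [Finset.sum_comm]
  exact Finset.sum_congr rfl fun x _ => Finset.sum_congr rfl fun y _ => by ring

theorem conj_third_pair (V : Matrix (Qubits 6) (Qubits 2) ℂ) (A B : Matrix (Fin 2) (Fin 2) ℂ)
    (k k' : Qubits 2) :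
    (Vᴴ * (qubitOp 4 A * qubitOp 5 B : Op 6) * V) k k' =
      ∑ c : Fin 2 × Fin 2, ∑ c' : Fin 2 × Fin 2, A c.1 c'.1 * B c.2 c'.2 *
        ∑ a, ∑ b, V (joinPairs a b c') k' * star (V (joinPairs a b c) k) := by
  have hsum : ∀ a b c, ∑ y, (qubitOp 4 A * qubitOp 5 B : Op 6) (joinPairs a b c) y *
      (V y k' * star (V (joinPairs a b c) k)) =
      ∑ c' : Fin 2 × Fin 2, A c.1 c'.1 * B c.2 c'.2 *
        (V (joinPairs a b c') k' * star (V (joinPairs a b c) k)) := by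
    intro a b c
    rw [sum_qubits_six, Finset.sum_eq_single a, Finset.sum_eq_single b]
    · exact Finset.sum_congr rfl fun c' _ => by
        rw [qubitOp_mul_qubitOp_joinPairs, if_pos ⟨rfl, rfl⟩]
    · intro b' _ hb
      exact Finset.sum_eq_zero fun c' _ => by
        rw [qubitOp_mul_qubitOp_joinPairs, if_neg fun h => hb h.2, zero_mul]
    · simp
    · intro a' _ ha
      exact Finset.sum_eq_zero fun b' _ => Finset.sum_eq_zero fun c' _ => by
        rw [qubitOp_mul_qubitOp_joinPairs, if_neg fun h => ha h.1, zero_mul]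
    · simp
  rw [conj_apply_eq_sum, sum_qubits_six]
  simp only [hsum, Finset.mul_sum]
  rw [Finset.sum_congr rfl fun a _ => Finset.sum_comm, Finset.sum_comm]
  refine Finset.sum_congr rfl fun c _ => ?_
  rw [Finset.sum_congr rfl fun a _ => Finset.sum_comm, Finset.sum_comm]

/-- Correcting one error means detecting two: the Knill-Laflamme conditions cover all products of
operators on qubits `4` and `5`. Matrix units there read off single entries of the reduced operator.
-/
theorem SatisfiesKnillLaflamme.no_leak_third_pair {V : Matrix (Qubits 6) (Qubits 2) ℂ}
    (hV : SatisfiesKnillLaflamme V) :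
    ∃ ρ : Matrix (Fin 2 × Fin 2) (Fin 2 × Fin 2) ℂ, ∀ k k' c c',
      ∑ a, ∑ b, V (joinPairs a b c) k * star (V (joinPairs a b c') k') =
        if k = k' then ρ c c' else 0 := by
  choose f hf using fun c c' : Fin 2 × Fin 2 =>
    hV.2 4 5 (Matrix.single c'.1 c.1 1) (Matrix.single c'.2 c.2 1)
  refine ⟨Matrix.of f, fun k k' c c' => ?_⟩
  have h := congrFun (congrFun (hf c c') k') k
  rw [conj_third_pair, Finset.sum_eq_single c', Finset.sum_eq_single c] at h
  · simpa [Matrix.one_apply, eq_comm] using h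
  · intro d _ hd
    have : ¬ (c.1 = d.1 ∧ c.2 = d.2) := fun h => hd (Prod.ext h.1.symm h.2.symm)
    simp only [Matrix.single_apply, true_and]
    split_ifs <;> simp_all
  · simp
  · intro d _ hd
    have : ¬ (c'.1 = d.1 ∧ c'.2 = d.2) := fun h => hd (Prod.ext h.1.symm h.2.symm)
    refine Finset.sum_eq_zero fun d' _ => ?_
    simp only [Matrix.single_apply]
    split_ifs <;> simp_all
  · simp

/-- A `((6, 4, 3))` code is pure on the third pair of qubits. -/
theorem SatisfiesKnillLaflamme.conj_third_pair_eq {V : Matrix (Qubits 6) (Qubits 2) ℂ}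
    (hV : SatisfiesKnillLaflamme V) (A B : Matrix (Fin 2) (Fin 2) ℂ) :
    Vᴴ * (qubitOp 4 A * qubitOp 5 B : Op 6) * V = (A.trace * B.trace / 4) • (1 : Op 2) := by
  obtain ⟨ρ₃, h₃⟩ := hV.no_leak_third_pair
  -- Cyclic shifts by `4` and `2` bring the first and the second pair into the third place.
  obtain ⟨ρ₁, h₁⟩ := (hV.permute (Equiv.addRight 4)).no_leak_third_pair
  obtain ⟨ρ₂, h₂⟩ := (hV.permute (Equiv.addRight 2)).no_leak_third_pair
  have e₁ : ∀ a b c, joinPairs b c a ∘ Equiv.addRight (4 : Fin 6) = joinPairs a b c := by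
    intro a b c; funext i; fin_cases i <;> rfl
  have e₂ : ∀ a b c, joinPairs c a b ∘ Equiv.addRight (2 : Fin 6) = joinPairs a b c := by
    intro a b c; funext i; fin_cases i <;> rfl
  simp only [Matrix.submatrix_apply, e₁, id] at h₁
  simp only [Matrix.submatrix_apply, e₂, id] at h₂
  have hnorm : ∀ k, ∑ a, ∑ b, ∑ c, V (joinPairs a b c) k * star (V (joinPairs a b c) k) = 1 := by
    intro k
    have h := congrFun (congrFun hV.1 k) k
    rw [Matrix.mul_apply, sum_qubits_six, Matrix.one_apply_eq] at h
    simpa only [Matrix.conjTranspose_apply, mul_comm] using h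
  have hρ := eq_of_no_leak (fun k a b c => V (joinPairs a b c) k) ρ₁ ρ₂ ρ₃ (by simp) (by simp)
    (by simp) (by simp) h₁ (fun k k' b b' => by rw [Finset.sum_comm, h₂]) h₃ hnorm
  ext k k'
  rw [conj_third_pair]
  simp only [h₃, hρ, Matrix.smul_apply, Matrix.one_apply, eq_comm (a := k')]
  by_cases hk : k = k'
  · simp [hk, Matrix.trace, Fintype.sum_prod_type]
    ring
  · simp [hk]

theorem SatisfiesKnillLaflamme.conj_pair {V : Matrix (Qubits 6) (Qubits 2) ℂ}
    (hV : SatisfiesKnillLaflamme V) {i j : Fin 6} (hij : i ≠ j)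
    (A B : Matrix (Fin 2) (Fin 2) ℂ) :
    Vᴴ * (qubitOp i A * qubitOp j B : Op 6) * V = (A.trace * B.trace / 4) • (1 : Op 2) := by
  obtain ⟨τ, h4, h5⟩ : ∃ τ : Equiv.Perm (Fin 6), τ 4 = i ∧ τ 5 = j := by
    -- The first swap takes `4` to `i`; the second takes the image of `5` to `j` and fixes `i`.
    refine ⟨Equiv.swap (Equiv.swap 4 i 5) j * Equiv.swap 4 i, ?_, ?_⟩
    · rw [Equiv.Perm.mul_apply, Equiv.swap_apply_left, Equiv.swap_apply_of_ne_of_ne _ hij]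
      intro h
      have := congrArg (Equiv.swap 4 i) h
      rw [Equiv.swap_apply_right, Equiv.swap_apply_self] at this
      exact absurd this (by decide)
    · rw [Equiv.Perm.mul_apply, Equiv.swap_apply_left]
  rw [← (hV.permute τ.symm).conj_third_pair_eq, conj_mul_submatrix_comp, Equiv.symm_symm, h4, h5]

theorem SatisfiesKnillLaflamme.conj_single {V : Matrix (Qubits 6) (Qubits 2) ℂ}
    (hV : SatisfiesKnillLaflamme V) (i : Fin 6) (A : Matrix (Fin 2) (Fin 2) ℂ) :
    Vᴴ * (qubitOp i A : Op 6) * V = (A.trace / 2) • (1 : Op 2) := by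
  obtain ⟨j, hj⟩ := exists_ne i
  have h := hV.conj_pair hj.symm A 1
  rw [qubitOp_one, Matrix.mul_one] at h
  rw [h]
  congr 1
  simp
  ring

/-! ### The Hamming bound -/

/-- The identity and the non-identity single-qubit Pauli errors on six qubits. -/
def pauliError : Option (Fin 6 × Fin 3) → Op 6
  | none => 1
  | some (i, p) => qubitOp i (![Pauli.X, Pauli.Y, Pauli.Z] p).toMatrix

theorem pauliError_conjTranspose (a : Option (Fin 6 × Fin 3)) :
    (pauliError a)ᴴ = pauliError a := by
  rcases a with _ | ⟨i, p⟩
  · exact Matrix.conjTranspose_one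
  · rw [pauliError, qubitOp_conjTranspose, pauli_conjTranspose]

/-- Nondegeneracy: between code states a product of errors contributes only its normalized trace,
which vanishes for distinct Pauli errors. -/
theorem SatisfiesKnillLaflamme.conj_pauliError {V : Matrix (Qubits 6) (Qubits 2) ℂ}
    (hV : SatisfiesKnillLaflamme V) (a b : Option (Fin 6 × Fin 3)) :
    Vᴴ * (pauliError a * pauliError b) * V = if a = b then (1 : Op 2) else 0 := by
  have htr : ∀ p : Fin 3, (![Pauli.X, Pauli.Y, Pauli.Z] p).toMatrix.trace = 0 := by
    intro p; fin_cases p <;> simp [Pauli.toMatrix, Matrix.trace_fin_two]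
  have htr2 : ∀ p q : Fin 3, p ≠ q → ((![Pauli.X, Pauli.Y, Pauli.Z] p).toMatrix *
      (![Pauli.X, Pauli.Y, Pauli.Z] q).toMatrix).trace = 0 := by
    intro p q hpq
    fin_cases p <;> fin_cases q <;>
      first
      | exact absurd rfl hpq
      | simp [Pauli.toMatrix, Matrix.trace_fin_two]
  rcases a with _ | ⟨i, p⟩ <;> rcases b with _ | ⟨j, q⟩
  · simp [pauliError, hV.1]
  · simp [pauliError, hV.conj_single, htr]
  · simp [pauliError, hV.conj_single, htr]
  · simp only [pauliError]
    by_cases hij : i = j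
    · subst hij
      rw [qubitOp_mul]
      by_cases hpq : p = q
      · subst hpq
        rw [pauli_mul_self, qubitOp_one, Matrix.mul_one, hV.1, if_pos rfl]
      · rw [hV.conj_single, htr2 p q hpq, if_neg (by simp [hpq])]
        simp
    · rw [hV.conj_pair hij, htr, if_neg (by simp [hij])]
      simp

/-- The columns of `G`, one for each error and basis state of the code, would be `19 * 4 = 76`
orthonormal vectors in dimension `2 ^ 6 = 64`. -/
theorem not_satisfiesKnillLaflamme (V : Matrix (Qubits 6) (Qubits 2) ℂ) :
    ¬ SatisfiesKnillLaflamme V := by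
  intro hV
  let G : Matrix (Qubits 6) (Option (Fin 6 × Fin 3) × Qubits 2) ℂ :=
    Matrix.of fun x q => (pauliError q.1 * V) x q.2
  have hG : Gᴴ * G = 1 := by
    ext ⟨a, k⟩ ⟨b, k'⟩
    have h := congrFun (congrFun (hV.conj_pauliError a b) k) k'
    have hprod : Vᴴ * (pauliError a * pauliError b) * V =
        (pauliError a * V)ᴴ * (pauliError b * V) := by
      rw [Matrix.conjTranspose_mul, pauliError_conjTranspose]
      simp only [Matrix.mul_assoc]
    rw [hprod] at h
    calc (Gᴴ * G) (a, k) (b, k') = ((pauliError a * V)ᴴ * (pauliError b * V)) k k' := rfl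
      _ = _ := by
        rw [h]
        by_cases hab : a = b <;> simp [hab, Matrix.one_apply]
  have h1 := Matrix.rank_mul_le_right Gᴴ G
  have h2 := Matrix.rank_le_card_height G
  rw [hG, Matrix.rank_one] at h1
  simp only [Fintype.card_prod, Fintype.card_option, Fintype.card_fun, Fintype.card_fin] at h1 h2
  omega

theorem not_existsQECC : ¬ ExistsQECC 6 2 1 := by
  intro h
  obtain ⟨V, hV⟩ := exists_knillLaflamme_of_existsQECC 0 h
  exact not_satisfiesKnillLaflamme V hV

end TwoWayEPP

theorem mainTheorem4 :
    -- `XXXX`, `ZZZZ` define a `[[4,2]]` code that detects every single-qubit Pauli error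
    (Commute (TwoWayEPP.pauliOp TwoWayEPP.xxxx) (TwoWayEPP.pauliOp TwoWayEPP.zzzz) ∧
      Module.finrank ℂ (TwoWayEPP.syndromeSpace
        [(TwoWayEPP.xxxx, false), (TwoWayEPP.zzzz, false)]) = 2 ^ 2 ∧
      ∀ (i : Fin 4) (p : TwoWayEPP.Pauli), p ≠ TwoWayEPP.Pauli.I →
        ∃ M ∈ [TwoWayEPP.xxxx, TwoWayEPP.zzzz],
          ¬ Commute (TwoWayEPP.pauliOp (Function.update (fun _ => TwoWayEPP.Pauli.I) i p))
              (TwoWayEPP.pauliOp M)) ∧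
    -- the protocol built on this code, with a suitable decoding operation for each result
    (∃ D : Bool → Bool → TwoWayEPP.Op 4,
      (∀ a₁ a₂, TwoWayEPP.IsDecoding
        [(TwoWayEPP.xxxx, a₁), (TwoWayEPP.zzzz, a₂)]
        (Fin.castLEEmb (by norm_num : 2 ≤ 4)) (D a₁ a₂)) ∧
      (TwoWayEPP.sixPairProtocol D).IsTwoEPP ∧
      (TwoWayEPP.sixPairProtocol D).Corrects 1) ∧
    -- no quantum error-correcting code achieves this
    ¬ TwoWayEPP.ExistsQECC 6 2 1 := by
  refine ⟨⟨TwoWayEPP.commute_xxxx_zzzz, TwoWayEPP.finrank_syndromeSpace _ _,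
    TwoWayEPP.detects_single_pauli⟩, ⟨TwoWayEPP.decoder, fun a₁ a₂ =>
      TwoWayEPP.isDecoding_decoder a₁ a₂ _, TwoWayEPP.sixPairProtocol_isTwoEPP,
      TwoWayEPP.sixPairProtocol_corrects⟩, TwoWayEPP.not_existsQECC⟩
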